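/- Let $k\ge 1$, let ${\bf n}=(n_1,\dots,n_k)$ and ${\bf m}=(m_1,\dots,m_k)$ be tuples of positive integers, and let ${\bf f}=(f_1,\dots,f_k)$, where $f_i=\sum_{\alpha\in\mathbb F_{n_i}^+}a_{i,\alpha}Z_\alpha$ is a positive regular free holomorphic function in $n_i$ noncommuting indeterminates; that is, with $\mathbb F_{n}^+$ the free monoid on $g_1,\dots,g_{n}$ and $|\alpha|$ the length of a word $\alpha$, we have $a_{i,\alpha}\ge 0$, $a_{i,1}=0$ for the empty word $1$, $a_{i,g_j}>0$ for $1\le j\le n_i$, and $\limsup_{l\to\infty}\big(\sum_{|\alpha|=l}|a_{i,\alpha}|^2\big)^{1/2l}<\infty$. For a word $\alpha\in\mathbb F_{n_i}^+$ put $b_{i,1}=1$ and, for $|\alpha|\ge1$, $$b_{i,\alpha}=\sum_{p=1}^{|\alpha|}\ \sum_{\gamma_1\cdots\gamma_p=\alpha,\ |\gamma_1|,\dots,|\gamma_p|\ge1}a_{i,\gamma_1}\cdots a_{i,\gamma_p}\binom{p+m_i-1}{m_i-1}.$$ Let $F^2(H_{n_i})$ be the full Fock space, with orthonormal basis $(e_\alpha)_{\alpha\in\mathbb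 F_{n_i}^+}$, let $W_{i,j}$ be the bounded operator on it with $W_{i,j}e_\alpha=\sqrt{b_{i,\alpha}/b_{i,g_j\alpha}}\;e_{g_j\alpha}$, and let ${\bf W}_{i,j}=I\otimes\cdots\otimes W_{i,j}\otimes\cdots\otimes I$ (with $W_{i,j}$ at the $i$-th place) on $\bigotimes_{i=1}^kF^2(H_{n_i})$. Write $\mathcal F_{\mathcal H}=(\bigotimes_{i=1}^kF^2(H_{n_i}))\otimes\mathcal H$ (Hilbert tensor product) for a complex Hilbert space $\mathcal H$. For a tuple $X=(X_1,\dots,X_n)$ of bounded operators on a Hilbert space and a positive regular $f=\sum_\alpha a_\alpha Z_\alpha$ in $n$ indeterminates, put $$\Phi_{f,X}(Y)=\sum_{l=1}^\infty\sum_{|\alpha|=l}a_\alpha X_\alpha YX_\alpha^*\quad\text{(weak operator topology)},\qquad X_\alpha=X_{j_1}\cdots X_{j_l}\ \text{ for }\ \alpha=g_{j_1}\cdots g_{j_l}.$$ A bounded operator $M:\mathcal F_{\mathcal E}\to\mathcal F_{\mathcal H}$ is called multi-analytic with respect to ${\bf W}$ if $M({\bf W}_{i,j}\otimes I_{\mathcal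 E})=({\bf W}_{i,j}\otimes I_{\mathcal H})M$ for all $i,j$, and inner multi-analytic if it is moreover a partial isometry. Let $\mathcal H$ be a complex Hilbert space and let ${\bf W}_i\otimes I_{\mathcal H}=({\bf W}_{i,1}\otimes I_{\mathcal H},\dots,{\bf W}_{i,n_i}\otimes I_{\mathcal H})$. Then for each $i$ the series defining $\Phi_{f_i,{\bf W}_i\otimes I_{\mathcal H}}(Y)$ converges in the weak operator topology for every $Y\in B(\mathcal F_{\mathcal H})$. For ${\bf p}\in\mathbb Z_+^k$ put $${\bf\Delta}^{\bf p}(Y)=(id-\Phi_{f_1,{\bf W}_1\otimes I_{\mathcal H}})^{p_1}\cdots(id-\Phi_{f_k,{\bf W}_k\otimes I_{\mathcal H}})^{p_k}(Y).$$ (a) For every $Y\in B(\mathcal F_{\mathcal H})$ the following are equivalent: (i) there are a Hilbert space $\mathcal E$ and a multi-analytic operator $M:\mathcal F_{\mathcal E}\to\mathcal F_{\mathcal H}$ with $Y=MM^*$; (ii) ${\bf\Delta}^{\bf p}(Y)\ge0$ for all ${\bf p}\in\mathbb Z_+^k$ with ${\bf p}\le{\bf m}$ (coordinatewise) and ${\bf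 p}\ne0$. (b) Let $\mathcal M\subset\mathcal F_{\mathcal H}$ be a closed subspace that is invariant under all ${\bf W}_{i,j}\otimes I_{\mathcal H}$, and let $P_{\mathcal M}$ be the orthogonal projection onto it. Then $\mathcal M$ is of Beurling type, i.e. $\mathcal M=\Psi(\mathcal F_{\mathcal E})$ for some Hilbert space $\mathcal E$ and some inner multi-analytic operator $\Psi:\mathcal F_{\mathcal E}\to\mathcal F_{\mathcal H}$, if and only if ${\bf\Delta}^{\bf p}(P_{\mathcal M})\ge0$ for all ${\bf p}\in\mathbb Z_+^k$ with ${\bf p}\le{\bf m}$. (c) Let $\mathcal M$ be as in (b), let ${\bf m}=(1,\dots,1)$, and let the tuple of restrictions $V_{i,j}=({\bf W}_{i,j}\otimes I_{\mathcal H})|_{\mathcal M}\in B(\mathcal M)$ be doubly commuting, i.e. $V_{i,p}V_{j,q}^*=V_{j,q}^*V_{i,p}$ whenever $i\ne j$. Then ${\bf\Delta}^{\bf p}(P_{\mathcal M})\ge0$ for all ${\bf p}\le{\bf m}$, and consequently $\mathcal M$ is of Beurling type. -/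

import Mathlib

open Filter Topology

universe u v

noncomputable section

namespace Polydomain

/-! ### Positive regular free holomorphic functions

Words in `n` letters are elements of `FreeMonoid (Fin n)`; the word `1` is the empty word. -/

/-- A positive regular free holomorphic function `f = ∑ a_α Z_α` in `n` noncommuting
indeterminates: `a_α ≥ 0`, `a_1 = 0`, `a_{g_j} > 0` for every letter, and
`limsup_k (∑_{|α| = k} |a_α|²)^{1/(2k)} < ∞`. -/
structure PositiveRegular (n : ℕ) where
  /-- the coefficient `a_α` of the word `α` -/
  coeff : FreeMonoid (Fin n) → ℝ
  coeff_nonneg : ∀ α, 0 ≤ coeff α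
  coeff_one : coeff 1 = 0
  coeff_of_pos : ∀ j : Fin n, 0 < coeff (FreeMonoid.of j)
  limsup_lt_top :
    limsup (fun k : ℕ =>
      (∑ w : Fin k → Fin n, ENNReal.ofReal (|coeff (FreeMonoid.ofList (List.ofFn w))| ^ 2))
        ^ (1 / (2 * (k : ℝ)))) atTop < ⊤

/-- The coefficients `b_α^{(m)} = ∑_p ∑_{γ₁ ⋯ γ_p = α, |γ_i| ≥ 1} a_{γ₁} ⋯ a_{γ_p} C(p+m-1, m-1)`.
Factorisations of `α` into `p` nonempty words are the compositions of `|α|` of length `p`. The empty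
word has just the empty factorisation, so that `b_1^{(m)} = 1`. -/
def bCoeff {n : ℕ} (a : FreeMonoid (Fin n) → ℝ) (m : ℕ) (α : FreeMonoid (Fin n)) : ℝ :=
  ∑ c : Composition α.length,
    ((α.toList.splitWrtComposition c).map fun γ => a (FreeMonoid.ofList γ)).prod
      * ((c.length + m - 1).choose (m - 1) : ℝ)

theorem bCoeff_one {n : ℕ} (a : FreeMonoid (Fin n) → ℝ) (m : ℕ) : bCoeff a m 1 = 1 := by
  have h : ∀ c : Composition (FreeMonoid.length (1 : FreeMonoid (Fin n))), c.length = 0 := by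
    intro c
    exact Nat.le_zero.1 c.length_le
  have h2 : ∀ c : Composition (FreeMonoid.length (1 : FreeMonoid (Fin n))),
      List.splitWrtComposition (FreeMonoid.toList (1 : FreeMonoid (Fin n))) c = [] := by
    intro c
    apply List.eq_nil_of_length_eq_zero
    rw [List.length_splitWrtComposition, h]
  unfold bCoeff
  simp only [h, h2]
  have h3 : Fintype.card (Composition (FreeMonoid.length (1 : FreeMonoid (Fin n)))) = 1 := by
    rw [composition_card]; rfl
  simp only [List.map_nil, List.prod_nil, Finset.sum_const, Finset.card_univ, h3]
  simp

/-- The composition `(1, c₁, c₂, …)`. -/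
def consOne {N : ℕ} (c : Composition N) : Composition (N + 1) where
  blocks := 1 :: c.blocks
  blocks_pos := by
    intro i hi
    rcases List.mem_cons.1 hi with h | h
    · omega
    · exact c.blocks_pos h
  blocks_sum := by simp [c.blocks_sum, add_comm]

theorem consOne_injective {N : ℕ} : Function.Injective (consOne (N := N)) := by
  intro c d h
  have : (1 :: c.blocks) = 1 :: d.blocks := congrArg Composition.blocks h
  exact Composition.ext (List.cons.inj this).2

theorem bCoeff_term_nonneg {n : ℕ} (f : PositiveRegular n) (m N : ℕ) (l : List (Fin n))
    (c : Composition N) :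
    0 ≤ ((l.splitWrtComposition c).map fun γ => f.coeff (FreeMonoid.ofList γ)).prod
      * ((c.length + m - 1).choose (m - 1) : ℝ) := by
  refine mul_nonneg (List.prod_nonneg ?_) (Nat.cast_nonneg _)
  intro x hx
  obtain ⟨γ, -, rfl⟩ := List.mem_map.1 hx
  exact f.coeff_nonneg _

theorem bCoeff_of_mul {n : ℕ} (f : PositiveRegular n) (m : ℕ) (j : Fin n)
    (α : FreeMonoid (Fin n)) :
    f.coeff (FreeMonoid.of j) * bCoeff f.coeff m α
      ≤ bCoeff f.coeff m (FreeMonoid.of j * α) := by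
  have key : ∀ c : Composition α.length,
      f.coeff (FreeMonoid.of j) *
        (((α.toList.splitWrtComposition c).map fun γ => f.coeff (FreeMonoid.ofList γ)).prod
          * ((c.length + m - 1).choose (m - 1) : ℝ)) ≤
      (((j :: α.toList).splitWrtComposition (consOne c)).map
          fun γ => f.coeff (FreeMonoid.ofList γ)).prod
          * (((consOne c).length + m - 1).choose (m - 1) : ℝ) := by
    intro c
    have e : (j :: α.toList).splitWrtComposition (consOne c)
        = [j] :: α.toList.splitWrtComposition c := by
      simp [List.splitWrtComposition, consOne, List.splitWrtCompositionAux_cons]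
    have hl : (consOne c).length = c.length + 1 := by
      simp [consOne, Composition.length]
    rw [e, hl, List.map_cons, List.prod_cons, FreeMonoid.ofList_singleton, ← mul_assoc]
    refine mul_le_mul_of_nonneg_left ?_ ?_
    · exact_mod_cast Nat.choose_le_choose _ (by omega)
    · refine mul_nonneg (f.coeff_nonneg _) (List.prod_nonneg ?_)
      intro x hx
      obtain ⟨γ, -, rfl⟩ := List.mem_map.1 hx
      exact f.coeff_nonneg _
  unfold bCoeff
  rw [Finset.mul_sum]
  refine (Finset.sum_le_sum fun c _ => key c).trans ?_
  have hm := Finset.sum_map (Finset.univ : Finset (Composition α.length))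
    ⟨consOne, consOne_injective⟩ (fun c : Composition (α.length + 1) =>
      (((j :: α.toList).splitWrtComposition c).map fun γ => f.coeff (FreeMonoid.ofList γ)).prod
          * ((c.length + m - 1).choose (m - 1) : ℝ))
  refine (le_of_eq hm.symm).trans ?_
  exact Finset.sum_le_univ_sum_of_nonneg
    (fun c => bCoeff_term_nonneg f m _ (j :: α.toList) c)

theorem bCoeff_pos {n : ℕ} (f : PositiveRegular n) (m : ℕ) (α : FreeMonoid (Fin n)) :
    0 < bCoeff f.coeff m α := by
  induction α using FreeMonoid.inductionOn' with
  | one => rw [bCoeff_one]; exact one_pos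
  | of_mul j α ih =>
    exact lt_of_lt_of_le (mul_pos (f.coeff_of_pos j) ih) (bCoeff_of_mul f m j α)

/-- The weights `√b_α / √b_{g_j α}` of the weighted left creation operators. -/
def weight {n : ℕ} (f : PositiveRegular n) (m : ℕ) (j : Fin n) (α : FreeMonoid (Fin n)) : ℝ :=
  √(bCoeff f.coeff m α) / √(bCoeff f.coeff m (FreeMonoid.of j * α))

theorem abs_weight_le {n : ℕ} (f : PositiveRegular n) (m : ℕ) (j : Fin n)
    (α : FreeMonoid (Fin n)) :
    |weight f m j α| ≤ 1 / √(f.coeff (FreeMonoid.of j)) := by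
  have hb := bCoeff_pos f m (FreeMonoid.of j * α)
  have ha := f.coeff_of_pos j
  unfold weight
  rw [abs_of_nonneg (by positivity), div_le_div_iff₀ (by positivity) (by positivity), one_mul,
    ← Real.sqrt_mul (bCoeff_pos f m α).le]
  refine Real.sqrt_le_sqrt ?_
  rw [mul_comm]
  exact bCoeff_of_mul f m j α

/-! ### Weighted shifts on `ℓ²` -/

section Shift

variable {ι : Type v} {H : Type u} [NormedAddCommGroup H] [InnerProductSpace ℂ H]

/-- The family with value `w a • x a` at `σ a`, and `0` off the range of `σ`. -/
def shiftFun (σ : ι → ι) (w : ι → ℝ) (x : ι → H) : ι → H :=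
  Function.extend σ (fun a => (w a : ℂ) • x a) 0

theorem shiftFun_apply {σ : ι → ι} (hσ : Function.Injective σ) (w : ι → ℝ) (x : ι → H) (a : ι) :
    shiftFun σ w x (σ a) = (w a : ℂ) • x a :=
  hσ.extend_apply _ _ _

theorem shiftFun_of_notMem (σ : ι → ι) (w : ι → ℝ) (x : ι → H) {b : ι} (hb : b ∉ Set.range σ) :
    shiftFun σ w x b = 0 := by
  unfold shiftFun
  rw [Function.extend_apply' _ _ _ hb]
  rfl

theorem norm_sq_summable {H : Type u} [NormedAddCommGroup H] (x : lp (fun _ : ι => H) 2) : Summable fun a => ‖x a‖ ^ 2 := by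
  have := (lp.memℓp x).summable (by norm_num)
  simpa using this

theorem norm_sq_eq {H : Type u} [NormedAddCommGroup H] (x : lp (fun _ : ι => H) 2) : ‖x‖ ^ 2 = ∑' a, ‖x a‖ ^ 2 := by
  have := lp.norm_rpow_eq_tsum (p := 2) (by norm_num) x
  simpa using this

theorem shift_term_le (w : ι → ℝ) {C : ℝ} (hC : ∀ a, |w a| ≤ C) (x : ι → H) (a : ι) :
    ‖(w a : ℂ) • x a‖ ^ 2 ≤ C ^ 2 * ‖x a‖ ^ 2 := by
  rw [norm_smul, mul_pow, Complex.norm_real, Real.norm_eq_abs]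
  exact mul_le_mul_of_nonneg_right (pow_le_pow_left₀ (abs_nonneg _) (hC a) 2) (by positivity)

theorem shiftFun_summable {σ : ι → ι} (hσ : Function.Injective σ) (w : ι → ℝ) {C : ℝ}
    (hC : ∀ a, |w a| ≤ C) (x : lp (fun _ : ι => H) 2) :
    Summable fun b => ‖shiftFun σ w x b‖ ^ 2 := by
  rw [← hσ.summable_iff]
  · refine Summable.of_nonneg_of_le (fun _ => sq_nonneg _) (fun a => ?_)
      ((norm_sq_summable x).mul_left (C ^ 2))
    simp only [Function.comp, shiftFun_apply hσ]
    exact shift_term_le w hC x a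
  · intro b hb
    rw [shiftFun_of_notMem _ _ _ hb]
    simp

theorem shiftFun_memlp {σ : ι → ι} (hσ : Function.Injective σ) (w : ι → ℝ) {C : ℝ}
    (hC : ∀ a, |w a| ≤ C) (x : lp (fun _ : ι => H) 2) :
    Memℓp (E := fun _ : ι => H) (shiftFun σ w x) 2 := by
  refine memℓp_gen ?_
  simpa using shiftFun_summable hσ w hC x

/-- The bounded operator on `ℓ²(ι; H)` which sends the family `x` to the family with value
`w a • x a` at `σ a` and `0` off the range of `σ`; so `e_a ⊗ h ↦ w a • e_{σ a} ⊗ h`. -/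
def weightedShift (σ : ι → ι) (hσ : Function.Injective σ) (w : ι → ℝ) (C : ℝ)
    (hC : ∀ a, |w a| ≤ C) : lp (fun _ : ι => H) 2 →L[ℂ] lp (fun _ : ι => H) 2 :=
  LinearMap.mkContinuous
    { toFun := fun x => ⟨shiftFun σ w x, shiftFun_memlp hσ w hC x⟩
      map_add' := by
        intro x y
        ext b
        by_cases hb : b ∈ Set.range σ
        · obtain ⟨a, rfl⟩ := hb
          change shiftFun σ w (⇑(x + y)) (σ a) = shiftFun σ w x (σ a) + shiftFun σ w y (σ a)
          simp only [shiftFun_apply hσ, lp.coeFn_add, Pi.add_apply, smul_add]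
        · change shiftFun σ w (⇑(x + y)) b = shiftFun σ w x b + shiftFun σ w y b
          simp only [shiftFun_of_notMem _ _ _ hb, add_zero]
      map_smul' := by
        intro c x
        ext b
        by_cases hb : b ∈ Set.range σ
        · obtain ⟨a, rfl⟩ := hb
          change shiftFun σ w (⇑(c • x)) (σ a) = c • shiftFun σ w x (σ a)
          simp only [shiftFun_apply hσ, lp.coeFn_smul, Pi.smul_apply, smul_smul, mul_comm]
        · change shiftFun σ w (⇑(c • x)) b = c • shiftFun σ w x b
          simp only [shiftFun_of_notMem _ _ _ hb, smul_zero] }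
    |C| (by
      intro x
      refine abs_le_of_sq_le_sq' ?_ (by positivity) |>.2
      rw [mul_pow, sq_abs, norm_sq_eq, norm_sq_eq, ← tsum_mul_left]
      have h1 : ∑' b, ‖shiftFun σ w x b‖ ^ 2 = ∑' a, ‖shiftFun σ w x (σ a)‖ ^ 2 := by
        refine (hσ.tsum_eq (f := fun b => ‖shiftFun σ w x b‖ ^ 2) ?_).symm
        intro b hb
        by_contra hb'
        exact hb (by simp [shiftFun_of_notMem _ _ _ hb'])
      refine h1.le.trans ?_
      refine Summable.tsum_le_tsum (fun a => ?_)
        ((shiftFun_summable hσ w hC x).comp_injective hσ) ((norm_sq_summable x).mul_left _)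
      rw [shiftFun_apply hσ]
      exact shift_term_le w hC x a)

theorem weightedShift_apply (σ : ι → ι) (hσ : Function.Injective σ) (w : ι → ℝ) (C : ℝ)
    (hC : ∀ a, |w a| ≤ C) (x : lp (fun _ : ι => H) 2) (a : ι) :
    weightedShift σ hσ w C hC x (σ a) = (w a : ℂ) • x a :=
  shiftFun_apply hσ w x a

theorem weightedShift_apply_of_notMem (σ : ι → ι) (hσ : Function.Injective σ) (w : ι → ℝ) (C : ℝ)
    (hC : ∀ a, |w a| ≤ C) (x : lp (fun _ : ι => H) 2) {b : ι} (hb : b ∉ Set.range σ) :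
    weightedShift σ hσ w C hC x b = 0 :=
  shiftFun_of_notMem σ w x hb

end Shift

/-! ### Fock spaces and their tensor products -/

/-- The full Fock space `F²(H_n)`, as the Hilbert space with orthonormal basis `(e_α)` indexed by
the words in `n` letters. -/
abbrev Fock (n : ℕ) : Type :=
  lp (fun _ : FreeMonoid (Fin n) => ℂ) 2

/-- The Hilbert tensor product `(F²(H_{n_1}) ⊗ ⋯ ⊗ F²(H_{n_k})) ⊗ H`, as the space of square
summable families `(h_{α_1, …, α_k})` in `H`; such a family stands for
`∑ e_{α_1} ⊗ ⋯ ⊗ e_{α_k} ⊗ h_{α_1, …, α_k}`. See `pureTensor`, `inner_pureTensor` and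
`span_pureTensor_dense` for the identification with the Hilbert tensor product. -/
abbrev PolyFock {k : ℕ} (n : Fin k → ℕ) (H : Type u) [NormedAddCommGroup H] : Type u :=
  lp (fun _ : (∀ i, FreeMonoid (Fin (n i))) => H) 2

theorem hasSum_pi_prod {k : ℕ} {β : Fin k → Type v} (g : ∀ i, β i → ℂ)
    (hg : ∀ i, Summable fun a => ‖g i a‖) :
    (Summable fun α : ∀ i, β i => ‖∏ i, g i (α i)‖) ∧
      ∑' α : ∀ i, β i, ∏ i, g i (α i) = ∏ i, ∑' a, g i a := by
  induction k with
  | zero =>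
    exact ⟨(hasSum_fintype _).summable, by simp⟩
  | succ k ih =>
    obtain ⟨h1, h2⟩ := ih (fun i => g i.succ) (fun i => hg i.succ)
    have e : ∀ x : β 0 × (∀ i : Fin k, β i.succ),
        ∏ i, g i (Fin.consEquiv β x i) = g 0 x.1 * ∏ i : Fin k, g i.succ (x.2 i) := by
      intro x
      rw [Fin.prod_univ_succ]
      simp [Fin.consEquiv]
    constructor
    · rw [← (Fin.consEquiv β).summable_iff]
      refine ((hg 0).mul_norm h1).congr ?_
      intro x
      simp only [Function.comp, e]
    · rw [← (Fin.consEquiv β).tsum_eq]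
      simp only [e]
      rw [Fin.prod_univ_succ, ← h2, tsum_mul_tsum_of_summable_norm (hg 0) h1]

section Tensor

variable {k : ℕ} {n : Fin k → ℕ} {H : Type u} [NormedAddCommGroup H] [InnerProductSpace ℂ H]

theorem pureTensor_memlp (x : ∀ i, Fock (n i)) (h : H) :
    Memℓp (E := fun _ : (∀ i, FreeMonoid (Fin (n i))) => H)
      (fun α => (∏ i, x i (α i)) • h) 2 := by
  refine memℓp_gen ?_
  have := (hasSum_pi_prod (fun i a => (x i a) ^ 2)
    (fun i => by simpa using norm_sq_summable (x i))).1
  refine (this.mul_right (‖h‖ ^ 2)).congr ?_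
  intro α
  simp [norm_smul, mul_pow, Finset.prod_pow]

/-- The elementary tensor `x₁ ⊗ ⋯ ⊗ x_k ⊗ h`. -/
def pureTensor (x : ∀ i, Fock (n i)) (h : H) : PolyFock n H :=
  ⟨fun α => (∏ i, x i (α i)) • h, pureTensor_memlp x h⟩

theorem pureTensor_apply (x : ∀ i, Fock (n i)) (h : H) (α : ∀ i, FreeMonoid (Fin (n i))) :
    pureTensor x h α = (∏ i, x i (α i)) • h := rfl

theorem inner_pureTensor (x y : ∀ i, Fock (n i)) (h h' : H) :
    inner ℂ (pureTensor x h) (pureTensor y h') = (∏ i, inner ℂ (x i) (y i)) * inner ℂ h h' := by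
  have hs : ∀ i, Summable fun a => ‖inner ℂ (x i a) (y i a)‖ := by
    intro i
    refine Summable.of_nonneg_of_le (fun _ => norm_nonneg _) (fun a => ?_)
      ((norm_sq_summable (x i)).add (norm_sq_summable (y i)))
    refine (norm_inner_le_norm _ _).trans ?_
    nlinarith [sq_nonneg (‖x i a‖ - ‖y i a‖), sq_nonneg (‖x i a‖ + ‖y i a‖)]
  have := (hasSum_pi_prod (fun i a => (inner ℂ (x i a) (y i a) : ℂ)) hs).2
  simp only [lp.inner_eq_tsum]
  rw [← this, ← tsum_mul_right]
  refine tsum_congr fun α => ?_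
  rw [pureTensor_apply, pureTensor_apply, inner_smul_left, inner_smul_right, map_prod, ← mul_assoc,
    ← Finset.prod_mul_distrib]
  congr 1
  refine Finset.prod_congr rfl fun i _ => ?_
  simp [mul_comm]

open Classical in
theorem pureTensor_single (α : ∀ i, FreeMonoid (Fin (n i))) (h : H) :
    pureTensor (fun i => lp.single 2 (α i) (1 : ℂ)) h = lp.single 2 α h := by
  ext β
  rw [pureTensor_apply]
  by_cases hβ : β = α
  · subst hβ
    simp
  · obtain ⟨i, hi⟩ := Function.ne_iff.1 hβ
    rw [lp.single_apply_ne _ _ _ hβ, Finset.prod_eq_zero (Finset.mem_univ i), zero_smul]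
    exact lp.single_apply_ne _ _ _ hi

open Classical in
theorem span_pureTensor_dense :
    (Submodule.span ℂ (Set.range fun z : (∀ i, Fock (n i)) × H => pureTensor z.1 z.2)
      ).topologicalClosure = ⊤ := by
  rw [eq_top_iff]
  intro x _
  have hx := lp.hasSum_single (p := 2) (by norm_num) x
  refine (Submodule.isClosed_topologicalClosure _).mem_of_tendsto hx (Eventually.of_forall ?_)
  intro s
  refine Submodule.sum_mem _ fun α _ => Submodule.le_topologicalClosure _ (Submodule.subset_span ?_)
  exact ⟨(_, x α), pureTensor_single α (x α)⟩

end Tensor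

/-! ### The universal model -/

theorem of_mul_injective {n : ℕ} (j : Fin n) :
    Function.Injective fun α : FreeMonoid (Fin n) => FreeMonoid.of j * α := by
  intro α β h
  exact mul_left_cancel h

/-- The weighted left creation operator `W_{i,j}` on `F²(H_n)`:
`e_α ↦ (√b_α / √b_{g_j α}) e_{g_j α}`. -/
def leftCreation {n : ℕ} (f : PositiveRegular n) (m : ℕ) (j : Fin n) : Fock n →L[ℂ] Fock n :=
  weightedShift (fun α => FreeMonoid.of j * α) (of_mul_injective j) (weight f m j)
    (1 / √(f.coeff (FreeMonoid.of j))) (abs_weight_le f m j)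

/-- `(α_1, …, α_k) ↦ (α_1, …, g_j α_i, …, α_k)` -/
def leftMul {k : ℕ} {n : Fin k → ℕ} (i : Fin k) (j : Fin (n i))
    (α : ∀ i, FreeMonoid (Fin (n i))) : ∀ i, FreeMonoid (Fin (n i)) :=
  Function.update α i (FreeMonoid.of j * α i)

theorem leftMul_injective {k : ℕ} {n : Fin k → ℕ} (i : Fin k) (j : Fin (n i)) :
    Function.Injective (leftMul (n := n) i j) := by
  intro α β h
  funext l
  have hl := congrFun h l
  unfold leftMul at hl
  by_cases e : l = i
  · subst e
    simpa using hl
  · simpa [e] using hl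

section Model

variable {k : ℕ} {n : Fin k → ℕ} (f : ∀ i, PositiveRegular (n i)) (m : Fin k → ℕ)
  (H : Type u) [NormedAddCommGroup H] [InnerProductSpace ℂ H]

/-- The operator `𝐖_{i,j} ⊗ I_H`, where `𝐖_{i,j} = I ⊗ ⋯ ⊗ W_{i,j} ⊗ ⋯ ⊗ I` with `W_{i,j}` at the
`i`-th place; see `model_pureTensor`. -/
def model (i : Fin k) (j : Fin (n i)) : PolyFock n H →L[ℂ] PolyFock n H :=
  weightedShift (leftMul i j) (leftMul_injective i j) (fun α => weight (f i) (m i) j (α i))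
    (1 / √((f i).coeff (FreeMonoid.of j))) (fun α => abs_weight_le (f i) (m i) j (α i))

theorem model_pureTensor (i : Fin k) (j : Fin (n i)) (x : ∀ i, Fock (n i)) (h : H) :
    model f m H i j (pureTensor x h) =
      pureTensor (Function.update x i (leftCreation (f i) (m i) j (x i))) h := by
  have split : ∀ (y : ∀ i, Fock (n i)) (β : ∀ i, FreeMonoid (Fin (n i))),
      ∏ l, y l (β l) = y i (β i) * ∏ l ∈ Finset.univ.erase i, y l (β l) := by
    intro y β
    exact (Finset.mul_prod_erase _ (fun l => y l (β l)) (Finset.mem_univ i)).symm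
  ext β
  by_cases hβ : β ∈ Set.range (leftMul i j)
  · obtain ⟨α, rfl⟩ := hβ
    refine (weightedShift_apply (leftMul i j) (leftMul_injective i j) _ _ _ _ α).trans ?_
    rw [pureTensor_apply, pureTensor_apply, smul_smul]
    congr 1
    rw [split, split]
    have e1 : leftMul i j α i = FreeMonoid.of j * α i := by simp [leftMul]
    have e2 : leftCreation (f i) (m i) j (x i) (FreeMonoid.of j * α i)
        = (weight (f i) (m i) j (α i) : ℂ) • x i (α i) :=
      weightedShift_apply _ (of_mul_injective j) _ _ (abs_weight_le (f i) (m i) j) (x i) (α i)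
    rw [e1, Function.update_self, e2, smul_eq_mul, mul_assoc]
    congr 2
    refine Finset.prod_congr rfl fun l hl => ?_
    have hne : l ≠ i := (Finset.mem_erase.1 hl).1
    simp [leftMul, hne]
  · refine (weightedShift_apply_of_notMem (leftMul i j) (leftMul_injective i j) _ _ _ _ hβ).trans ?_
    rw [pureTensor_apply, split]
    have e3 : leftCreation (f i) (m i) j (x i) (β i) = 0 := by
      refine weightedShift_apply_of_notMem _ (of_mul_injective j) _ _ _ _ ?_
      rintro ⟨γ, hγ⟩
      refine hβ ⟨Function.update β i γ, ?_⟩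
      funext l
      by_cases e : l = i
      · subst e
        simpa [leftMul] using hγ
      · simp [leftMul, e]
    simp [e3]

end Model

/-! ### The completely positive maps `Φ_{f,X}` and the defect mappings -/

section Defect

variable {K : Type u} [NormedAddCommGroup K] [InnerProductSpace ℂ K] [CompleteSpace K]

/-- `∑_{1 ≤ l ≤ N} ∑_{|α| = l} a_α X_α Y X_α^*`, where `X_α = X_{j_1} ⋯ X_{j_l}` for
`α = g_{j_1} ⋯ g_{j_l}`. -/
def phiPartialSum {n : ℕ} (f : PositiveRegular n) (X : Fin n → K →L[ℂ] K) (Y : K →L[ℂ] K)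
    (N : ℕ) : K →L[ℂ] K :=
  ∑ l ∈ Finset.Icc 1 N, ∑ w : Fin l → Fin n,
    (f.coeff (FreeMonoid.ofList (List.ofFn w)) : ℂ) •
      (FreeMonoid.lift X (FreeMonoid.ofList (List.ofFn w)) ∘L Y ∘L
        ContinuousLinearMap.adjoint (FreeMonoid.lift X (FreeMonoid.ofList (List.ofFn w))))

/-- `Φ_{f,X}(Y) = ∑_{l ≥ 1} ∑_{|α| = l} a_α X_α Y X_α^*`, the limit being taken in the weak
operator topology (with an unspecified value where the series does not converge). -/
def phi {n : ℕ} (f : PositiveRegular n) (X : Fin n → K →L[ℂ] K) (Y : K →L[ℂ] K) : K →L[ℂ] K :=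
  ContinuousLinearMapWOT.toCLM
    (limUnder atTop fun N : ℕ =>
      (ContinuousLinearMapWOT.ofCLM (phiPartialSum f X Y N) : K →WOT[ℂ] K))

/-- `Δ^p_{f,T}(Y) = (id - Φ_{f_1,T_1})^{p_1} ⋯ (id - Φ_{f_k,T_k})^{p_k} (Y)`. -/
def defect {k : ℕ} {n : Fin k → ℕ} (f : ∀ i, PositiveRegular (n i))
    (T : ∀ i, Fin (n i) → K →L[ℂ] K) (p : Fin k → ℕ) (Y : K →L[ℂ] K) : K →L[ℂ] K :=
  Fin.foldr k (fun i Z => (fun Z' => Z' - phi (f i) (T i) Z')^[p i] Z) Y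

/-- `T_{i,p} T_{j,q}^* = T_{j,q}^* T_{i,p}` whenever `i ≠ j`. -/
def DoublyCommuting {k : ℕ} {n : Fin k → ℕ} (T : ∀ i, Fin (n i) → K →L[ℂ] K) : Prop :=
  ∀ i j, i ≠ j → ∀ (p : Fin (n i)) (q : Fin (n j)),
    T i p ∘L ContinuousLinearMap.adjoint (T j q) = ContinuousLinearMap.adjoint (T j q) ∘L T i p

/-- The restriction of an operator to an invariant subspace. -/
def restrictTo (T : K →L[ℂ] K) (M : Submodule ℂ K) (hM : ∀ x ∈ M, T x ∈ M) : M →L[ℂ] M :=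
  (T ∘L M.subtypeL).codRestrict M fun x => hM x x.2

end Defect

/-! ### Multi-analytic operators and Beurling type subspaces -/

section MultiAnalytic

/-- A partial isometry: isometric on the orthogonal complement of the kernel. -/
def IsPartialIsometry {K : Type u} {L : Type v} [NormedAddCommGroup K] [InnerProductSpace ℂ K]
    [NormedAddCommGroup L] [InnerProductSpace ℂ L] (V : K →L[ℂ] L) : Prop :=
  ∀ x ∈ (LinearMap.ker (V : K →ₗ[ℂ] L))ᗮ, ‖V x‖ = ‖x‖

variable {k : ℕ} {n : Fin k → ℕ} (f : ∀ i, PositiveRegular (n i)) (m : Fin k → ℕ)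

/-- `A (𝐖_{i,j} ⊗ I_E) = (𝐖_{i,j} ⊗ I_H) A` for all `i, j`. -/
def IsMultiAnalytic {E : Type u} {H : Type v} [NormedAddCommGroup E] [InnerProductSpace ℂ E]
    [NormedAddCommGroup H] [InnerProductSpace ℂ H] (A : PolyFock n E →L[ℂ] PolyFock n H) : Prop :=
  ∀ (i : Fin k) (j : Fin (n i)), A ∘L model f m E i j = model f m H i j ∘L A

/-- An inner multi-analytic operator is a multi-analytic partial isometry. -/
def IsInnerMultiAnalytic {E : Type u} {H : Type v} [NormedAddCommGroup E] [InnerProductSpace ℂ E]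
    [NormedAddCommGroup H] [InnerProductSpace ℂ H] (A : PolyFock n E →L[ℂ] PolyFock n H) : Prop :=
  IsMultiAnalytic f m A ∧ IsPartialIsometry A

/-- `M` is the range of an inner multi-analytic operator `(⊗ F²(H_{n_i})) ⊗ E → (⊗ F²(H_{n_i})) ⊗ H`
for some Hilbert space `E`. -/
def IsBeurlingType {H : Type u} [NormedAddCommGroup H] [InnerProductSpace ℂ H]
    (M : Submodule ℂ (PolyFock n H)) : Prop :=
  ∃ (E : Type u) (_ : NormedAddCommGroup E) (_ : InnerProductSpace ℂ E) (_ : CompleteSpace E)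
    (Ψ : PolyFock n E →L[ℂ] PolyFock n H),
    IsInnerMultiAnalytic f m Ψ ∧ (M : Set (PolyFock n H)) = Set.range Ψ

end MultiAnalytic

end Polydomain

end

noncomputable section

namespace Polydomain

/-! ### The coefficients of `(1 - f)^{-r}` -/

section Coefficients

variable {n : ℕ}

/-! Write `Φ_i` for the map attached to `f_i` and the model, and `b^(r)` for the coefficients of the
formal series `∏ i, (1 - f_i)^(-r_i)`, so that `b^(m)` is the product of the weights `b_{i,α}`.
Given a function `P` on vectors, consider `G_r(x) = ∑_β b^(r)_β P(W_β^* x)`. On a finitely supported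
`x` only finitely many `W_β^* x` are nonzero, so the formal identity `(1 - f_i) (1 - f_i)^(-(r_i+1))
= (1 - f_i)^(-r_i)` says literally that `id - Φ_i` sends `G_{r+e_i}` to `G_r`
(`formSum_sub_formPhi`). Moreover `id - Φ_i` is injective on forms over finitely supported vectors,
since backward shifts are nilpotent there (`form_eq_zero_of_eq_formPhi`). Hence the form of `Δ^p(Y)`
is `G_r` exactly when that of `Y` is `G_{r+p}` (`hasForm_defect`).

The weights are chosen so that `‖x‖² = ∑_β b^(m)_β ‖(W_β^* x)_1‖²` (`norm_sq_eq_formSum`). If `A` is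
multi-analytic, applying this to `A^* x` gives `A A^*` the form `G_m` with `P(x) = ‖(A^* x)_1‖²`;
then `Δ^p(A A^*)` has the form `G_{m-p}`, which is nonnegative because the coefficients are.
Conversely, if `Δ^m(Y) = C^* C`, then `Y` has the form `G_m` with `P(x) = ‖C x‖²`. So `B x = (√b_β C
W_β^* x)_β` is bounded with `B^* B = Y`, and it intertwines backward shifts; `A = B^*` is the
required factor (`exists_isMultiAnalytic`).

For a subspace, `P_M = A A^*` holds exactly when `A` is a partial isometry with range `M`, which
turns the factorization into the Beurling criterion. In the doubly commuting case `Δ^p(P_M)` is the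
compression of the defect of the identity of `M`, a product of commuting positive operators `I -
Φ_i(I)` (`isPositive_defect_of_doublyCommuting`). -/

/-- The lists of blocks of the compositions of `N`. -/
def blockLists (N : ℕ) : Finset (List ℕ) :=
  (Finset.univ : Finset (Composition N)).image Composition.blocks

theorem mem_blockLists {N : ℕ} {l : List ℕ} :
    l ∈ blockLists N ↔ (∀ i ∈ l, 0 < i) ∧ l.sum = N := by
  simp only [blockLists, Finset.mem_image, Finset.mem_univ, true_and]
  constructor
  · rintro ⟨c, rfl⟩
    exact ⟨fun i hi => c.blocks_pos hi, c.blocks_sum⟩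
  · rintro ⟨h1, h2⟩
    exact ⟨⟨l, fun {i} hi => h1 i hi, h2⟩, rfl⟩

/-- The sum over all factorisations of `α` into nonempty words `γ₁ ⋯ γ_p` of
`a_{γ₁} ⋯ a_{γ_p} g(p)`. -/
def factorSum (a : FreeMonoid (Fin n) → ℝ) (g : ℕ → ℝ) (α : List (Fin n)) : ℝ :=
  ∑ l ∈ blockLists α.length,
    ((α.splitWrtCompositionAux l).map fun γ => a (FreeMonoid.ofList γ)).prod * g l.length

theorem bCoeff_eq_factorSum (a : FreeMonoid (Fin n) → ℝ) (m : ℕ) (α : FreeMonoid (Fin n)) :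
    bCoeff a m α
      = factorSum a (fun p => ((p + m - 1).choose (m - 1) : ℝ)) α.toList := by
  unfold bCoeff factorSum blockLists
  rw [Finset.sum_image]
  · rfl
  · intro c _ d _ h
    exact Composition.ext h

theorem blockLists_succ (N : ℕ) :
    blockLists (N + 1) = (Finset.range (N + 1)).biUnion fun s =>
      (blockLists (N - s)).image (List.cons (s + 1)) := by
  ext l
  simp only [Finset.mem_biUnion, Finset.mem_image, mem_blockLists, Finset.mem_range]
  constructor
  · rintro ⟨h1, h2⟩
    cases l with
    | nil => simp at h2
    | cons b l =>
      have hb := h1 b (by simp)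
      simp only [List.sum_cons] at h2
      refine ⟨b - 1, by omega, l, ⟨fun i hi => h1 i (by simp [hi]), by omega⟩, ?_⟩
      congr 1
      omega
  · rintro ⟨s, hs, l, ⟨h1, h2⟩, rfl⟩
    refine ⟨?_, ?_⟩
    · intro i hi
      rcases List.mem_cons.1 hi with h | h
      · omega
      · exact h1 i h
    · simp only [List.sum_cons]
      omega

/-- A factorisation of a nonempty word is its first factor, of length `s + 1`, followed by a
factorisation of the rest with one factor fewer; hence the shift of `g`. -/
theorem factorSum_cons (a : FreeMonoid (Fin n) → ℝ) (g : ℕ → ℝ) (j : Fin n) (α : List (Fin n)) :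
    factorSum a g (j :: α) = ∑ s ∈ Finset.range (α.length + 1),
      a (FreeMonoid.ofList ((j :: α).take (s + 1))) *
        factorSum a (fun p => g (p + 1)) ((j :: α).drop (s + 1)) := by
  unfold factorSum
  rw [List.length_cons, blockLists_succ, Finset.sum_biUnion]
  · refine Finset.sum_congr rfl fun s _ => ?_
    rw [Finset.sum_image (fun _ _ _ _ h => (List.cons.inj h).2), Finset.mul_sum]
    have : ((j :: α).drop (s + 1)).length = α.length - s := by simp
    rw [this]
    refine Finset.sum_congr rfl fun l _ => ?_
    rw [List.splitWrtCompositionAux_cons, List.map_cons, List.prod_cons, List.length_cons,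
      mul_assoc]
  · intro s _ t _ hst
    rw [Function.onFun, Finset.disjoint_left]
    rintro l h1 h2
    obtain ⟨_, _, rfl⟩ := Finset.mem_image.1 h1
    obtain ⟨_, _, h⟩ := Finset.mem_image.1 h2
    exact hst (by have := (List.cons.inj h).1; omega)

theorem factorSum_nil (a : FreeMonoid (Fin n) → ℝ) (g : ℕ → ℝ) : factorSum a g [] = g 0 := by
  have : blockLists 0 = {[]} := by
    ext l
    rw [mem_blockLists, Finset.mem_singleton]
    constructor
    · rintro ⟨h1, h2⟩
      cases l with
      | nil => rfl
      | cons b l =>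
        have := h1 b (by simp)
        simp only [List.sum_cons] at h2
        omega
    · rintro rfl
      simp
  simp [factorSum, this, List.splitWrtCompositionAux]

theorem factorSum_add (a : FreeMonoid (Fin n) → ℝ) (g h : ℕ → ℝ) (α : List (Fin n)) :
    factorSum a (fun p => g p + h p) α = factorSum a g α + factorSum a h α := by
  simp only [factorSum, mul_add, Finset.sum_add_distrib]

/-- The hypotheses say `(1 - t) ∑ g(p) t^p = ∑ h(p) t^p`; the conclusion is this identity at `t =
f`, multiplied out. The cut `s = 0` contributes nothing because `a 1 = 0`. -/
theorem factorSum_recursion {a : FreeMonoid (Fin n) → ℝ} (ha : a 1 = 0) {g h : ℕ → ℝ}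
    (h0 : g 0 = h 0) (hg : ∀ p, g (p + 1) = g p + h (p + 1)) (α : List (Fin n)) :
    factorSum a g α = factorSum a h α + ∑ s ∈ Finset.range (α.length + 1),
      a (FreeMonoid.ofList (α.take s)) * factorSum a g (α.drop s) := by
  rw [Finset.sum_range_succ']
  have e : a (FreeMonoid.ofList (List.take 0 α)) = 0 := ha
  rw [e, zero_mul, add_zero]
  cases α with
  | nil => simp [factorSum_nil, h0]
  | cons j α =>
    rw [factorSum_cons, factorSum_cons, List.length_cons, ← Finset.sum_add_distrib]
    refine Finset.sum_congr rfl fun s _ => ?_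
    simp only [hg, factorSum_add]
    ring

open Classical in
/-- The coefficients of the formal power series `(1 - f)^{-r}`. -/
def bPow (a : FreeMonoid (Fin n) → ℝ) (r : ℕ) (α : FreeMonoid (Fin n)) : ℝ :=
  -- The truncated `m - 1` makes `bCoeff a 0` coincide with `bCoeff a 1`, so the exponent zero needs
  -- its own clause.
  if r = 0 then (if α = 1 then 1 else 0) else bCoeff a r α

theorem bPow_of_pos (a : FreeMonoid (Fin n) → ℝ) {r : ℕ} (hr : 1 ≤ r) (α : FreeMonoid (Fin n)) :
    bPow a r α = bCoeff a r α := by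
  rw [bPow, if_neg (by omega)]

theorem bPow_eq_factorSum (a : FreeMonoid (Fin n) → ℝ) (r : ℕ) (α : FreeMonoid (Fin n)) :
    bPow a r α = factorSum a (fun p =>
      if r = 0 then (if p = 0 then 1 else 0) else ((p + r - 1).choose (r - 1) : ℝ)) α.toList := by
  by_cases hr : r = 0
  · simp only [bPow, if_pos hr]
    by_cases hα : α = 1
    · subst hα
      rw [if_pos rfl]
      rw [FreeMonoid.toList_one, factorSum_nil, if_pos rfl]
    · rw [if_neg hα, factorSum]
      refine (Finset.sum_eq_zero fun l hl => ?_).symm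
      have : l.length ≠ 0 := by
        intro h0
        rw [List.length_eq_zero_iff] at h0
        subst h0
        have h2 := (mem_blockLists.1 hl).2
        exact hα (FreeMonoid.toList.injective (List.eq_nil_of_length_eq_zero h2.symm))
      rw [if_neg this, mul_zero]
  · simp only [bPow, if_neg hr]
    exact bCoeff_eq_factorSum a r α

/-- This is `(1 - f)^(-(r+1)) = (1 - f)^(-r) + f (1 - f)^(-(r+1))`, which for the binomial
coefficients is Pascal's rule. -/
theorem bPow_succ {a : FreeMonoid (Fin n) → ℝ} (ha : a 1 = 0) (r : ℕ) (α : FreeMonoid (Fin n)) :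
    bPow a (r + 1) α = bPow a r α + ∑ s ∈ Finset.range (α.toList.length + 1),
      a (FreeMonoid.ofList (α.toList.take s)) *
        bPow a (r + 1) (FreeMonoid.ofList (α.toList.drop s)) := by
  simp only [bPow_eq_factorSum]
  refine factorSum_recursion ha ?_ ?_ _
  · rcases r with _ | r <;> simp
  · intro p
    rcases r with _ | r
    · simp
    · simp only [Nat.add_one_ne_zero, if_false]
      norm_cast
      have e1 : p + 1 + (r + 1 + 1) - 1 = (p + r + 1) + 1 := by omega
      have e2 : r + 1 + 1 - 1 = r + 1 := by omega
      have e3 : p + (r + 1 + 1) - 1 = p + r + 1 := by omega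
      have e4 : p + 1 + (r + 1) - 1 = p + r + 1 := by omega
      rw [e1, e2, e3, e4, Nat.choose_succ_succ, Nat.add_sub_cancel, add_comm]

theorem bPow_nonneg (f : PositiveRegular n) (r : ℕ) (α : FreeMonoid (Fin n)) :
    0 ≤ bPow f.coeff r α := by
  unfold bPow
  split_ifs
  · exact zero_le_one
  · exact le_rfl
  · exact (bCoeff_pos f r α).le

theorem bPow_one (a : FreeMonoid (Fin n) → ℝ) (r : ℕ) : bPow a r 1 = 1 := by
  by_cases hr : r = 0
  · rw [bPow, if_pos hr, if_pos rfl]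
  · rw [bPow, if_neg hr, bCoeff_one]

/-- Iterating `bCoeff_of_mul` over the letters of `α` gives the product of their coefficients as
`c`. This bounds the weights of the shift by a whole word. -/
theorem exists_mul_bCoeff_le (f : PositiveRegular n) (m : ℕ) (α : FreeMonoid (Fin n)) :
    ∃ c : ℝ, 0 < c ∧ ∀ γ, c * bCoeff f.coeff m γ ≤ bCoeff f.coeff m (α * γ) := by
  induction α using FreeMonoid.inductionOn' with
  | one => exact ⟨1, one_pos, fun γ => by simp⟩
  | of_mul j α ih =>
    obtain ⟨c, hc, h⟩ := ih
    refine ⟨f.coeff (FreeMonoid.of j) * c, mul_pos (f.coeff_of_pos j) hc, fun γ => ?_⟩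
    rw [mul_assoc, mul_assoc]
    exact (mul_le_mul_of_nonneg_left (h γ) (f.coeff_nonneg _)).trans (bCoeff_of_mul f m j _)

end Coefficients

/-! ### Adjoints of weighted shifts -/

section ShiftAdjoint

variable {ι : Type v} {H : Type u} [NormedAddCommGroup H] [InnerProductSpace ℂ H]

theorem weightedShift_congr {σ τ : ι → ι} (hσ : Function.Injective σ) (hτ : Function.Injective τ)
    {w z : ι → ℝ} {C D : ℝ} (hC : ∀ a, |w a| ≤ C) (hD : ∀ a, |z a| ≤ D) (h1 : σ = τ)
    (h2 : w = z) :
    (weightedShift σ hσ w C hC : lp (fun _ : ι => H) 2 →L[ℂ] lp (fun _ : ι => H) 2)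
      = weightedShift τ hτ z D hD := by
  subst h1 h2
  rfl

open Classical in
theorem weightedShift_single (σ : ι → ι) (hσ : Function.Injective σ) (w : ι → ℝ) (C : ℝ)
    (hC : ∀ a, |w a| ≤ C) (a : ι) (h : H) :
    weightedShift σ hσ w C hC (lp.single 2 a h) = lp.single 2 (σ a) ((w a : ℂ) • h) := by
  ext b
  by_cases hb : b ∈ Set.range σ
  · obtain ⟨c, rfl⟩ := hb
    rw [weightedShift_apply]
    by_cases hc : c = a
    · subst hc
      simp
    · rw [lp.single_apply_ne _ _ _ hc, lp.single_apply_ne _ _ _ (hσ.ne hc), smul_zero]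
  · rw [weightedShift_apply_of_notMem _ _ _ _ _ _ hb, lp.single_apply_ne]
    rintro rfl
    exact hb ⟨a, rfl⟩

open Classical in
theorem adjoint_weightedShift_apply [CompleteSpace H] (σ : ι → ι) (hσ : Function.Injective σ)
    (w : ι → ℝ) (C : ℝ) (hC : ∀ a, |w a| ≤ C) (x : lp (fun _ : ι => H) 2) (a : ι) :
    ContinuousLinearMap.adjoint (weightedShift σ hσ w C hC) x a = (w a : ℂ) • x (σ a) := by
  refine ext_inner_left (E := H) ℂ fun h => ?_
  refine (lp.inner_single_left (𝕜 := ℂ) (G := fun _ : ι => H) a h _).symm.trans ?_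
  rw [ContinuousLinearMap.adjoint_inner_right, weightedShift_single, lp.inner_single_left,
    inner_smul_left, inner_smul_right, Complex.conj_ofReal]

end ShiftAdjoint

/-! ### Finitely supported families -/

section Finsupp

variable {k : ℕ} {n : Fin k → ℕ} {H : Type u} [NormedAddCommGroup H]

/-- The finitely supported families. -/
def IsFinsupp (x : PolyFock n H) : Prop :=
  (Function.support (x : (∀ i, FreeMonoid (Fin (n i))) → H)).Finite

-- Form identities are proved on these vectors, where sums over words are finite, and the resulting
-- closed conditions extend by continuity.
open Classical in
theorem IsFinsupp.dense : Dense {x : PolyFock n H | IsFinsupp x} := by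
  intro x
  have hx := lp.hasSum_single (p := 2) (by norm_num) x
  refine mem_closure_of_tendsto hx (Eventually.of_forall fun s => ?_)
  refine s.finite_toSet.subset fun β hβ => ?_
  by_contra h
  refine hβ ?_
  rw [lp.coeFn_sum, Finset.sum_apply]
  refine Finset.sum_eq_zero fun γ hγ => lp.single_apply_ne _ _ _ ?_
  rintro rfl
  exact h hγ

end Finsupp

/-! ### Shifts by tuples of words -/

section PolyShift

variable {k : ℕ} {n : Fin k → ℕ} (f : ∀ i, PositiveRegular (n i)) (m : Fin k → ℕ)

/-- The coefficients of `∏ i, (1 - f_i)^{-r_i}`. -/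
def polyPow (r : Fin k → ℕ) (β : ∀ i, FreeMonoid (Fin (n i))) : ℝ :=
  ∏ i, bPow (f i).coeff (r i) (β i)

/-- The product of the coefficients `b_{i, β_i}`. -/
def polyCoeff (β : ∀ i, FreeMonoid (Fin (n i))) : ℝ :=
  ∏ i, bCoeff (f i).coeff (m i) (β i)

theorem polyPow_nonneg (r : Fin k → ℕ) (β : ∀ i, FreeMonoid (Fin (n i))) : 0 ≤ polyPow f r β :=
  Finset.prod_nonneg fun i _ => bPow_nonneg (f i) (r i) (β i)

theorem polyCoeff_pos (β : ∀ i, FreeMonoid (Fin (n i))) : 0 < polyCoeff f m β :=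
  Finset.prod_pos fun i _ => bCoeff_pos (f i) (m i) (β i)

theorem polyCoeff_one : polyCoeff f m 1 = 1 :=
  Finset.prod_eq_one fun i _ => bCoeff_one (f i).coeff (m i)

theorem polyPow_eq_polyCoeff (hm : ∀ i, 1 ≤ m i) (β : ∀ i, FreeMonoid (Fin (n i))) :
    polyPow f m β = polyCoeff f m β :=
  Finset.prod_congr rfl fun i _ => bPow_of_pos _ (hm i) _

theorem polyPow_zero (β : ∀ i, FreeMonoid (Fin (n i))) (hβ : β ≠ 1) : polyPow f 0 β = 0 := by
  obtain ⟨i, hi⟩ := Function.ne_iff.1 hβ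
  refine Finset.prod_eq_zero (Finset.mem_univ i) ?_
  simp only [bPow, Pi.zero_apply, if_true]
  exact if_neg hi

theorem polyPow_one (r : Fin k → ℕ) : polyPow f r 1 = 1 :=
  Finset.prod_eq_one fun i _ => bPow_one (f i).coeff (r i)

theorem exists_polyWeight_le (β : ∀ i, FreeMonoid (Fin (n i))) :
    ∃ C : ℝ, ∀ γ, |√(polyCoeff f m γ) / √(polyCoeff f m (β * γ))| ≤ C := by
  choose c hc h using fun i => exists_mul_bCoeff_le (f i) (m i) (β i)
  have hc' : 0 < ∏ i, c i := Finset.prod_pos fun i _ => hc i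
  refine ⟨1 / √(∏ i, c i), fun γ => ?_⟩
  have hb := polyCoeff_pos f m (β * γ)
  rw [abs_of_nonneg (by positivity), div_le_div_iff₀ (by positivity) (by positivity), one_mul,
    ← Real.sqrt_mul (polyCoeff_pos f m γ).le]
  refine Real.sqrt_le_sqrt ?_
  rw [mul_comm, polyCoeff, polyCoeff, ← Finset.prod_mul_distrib]
  exact Finset.prod_le_prod (fun i _ => (mul_pos (hc i) (bCoeff_pos _ _ _)).le)
    fun i _ => h i (γ i)

variable (H : Type u) [NormedAddCommGroup H] [InnerProductSpace ℂ H]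

/-- The weighted shift `e_γ ⊗ h ↦ (√b_γ / √b_{βγ}) e_{βγ} ⊗ h`. -/
def polyShift (β : ∀ i, FreeMonoid (Fin (n i))) : PolyFock n H →L[ℂ] PolyFock n H :=
  weightedShift (fun γ => β * γ) (mul_right_injective β)
    (fun γ => √(polyCoeff f m γ) / √(polyCoeff f m (β * γ)))
    (exists_polyWeight_le f m β).choose (exists_polyWeight_le f m β).choose_spec

/-- The weights of `polyShift` are products over the coordinates, and all factors away from `i`
cancel in the quotient. -/
theorem model_eq_polyShift (i : Fin k) (j : Fin (n i)) :
    model f m H i j = polyShift f m H (Pi.mulSingle i (FreeMonoid.of j)) := by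
  have e : leftMul (n := n) i j = fun γ => Pi.mulSingle i (FreeMonoid.of j) * γ := by
    funext γ l
    by_cases h : l = i
    · subst h
      simp [leftMul]
    · simp [leftMul, h]
  refine weightedShift_congr _ _ _ _ e ?_
  funext γ
  have h1 : ∀ δ : ∀ i, FreeMonoid (Fin (n i)), polyCoeff f m δ
      = bCoeff (f i).coeff (m i) (δ i) *
        ∏ l ∈ Finset.univ.erase i, bCoeff (f l).coeff (m l) (δ l) := fun δ =>
    (Finset.mul_prod_erase _ (fun l => bCoeff (f l).coeff (m l) (δ l)) (Finset.mem_univ i)).symm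
  have h2 : ∏ l ∈ Finset.univ.erase i, bCoeff (f l).coeff (m l)
        ((Pi.mulSingle i (FreeMonoid.of j) * γ : ∀ i, FreeMonoid (Fin (n i))) l)
      = ∏ l ∈ Finset.univ.erase i, bCoeff (f l).coeff (m l) (γ l) := by
    refine Finset.prod_congr rfl fun l hl => ?_
    rw [Pi.mul_apply, Pi.mulSingle_eq_of_ne (Finset.mem_erase.1 hl).1, one_mul]
  have hpos : 0 < ∏ l ∈ Finset.univ.erase i, bCoeff (f l).coeff (m l) (γ l) :=
    Finset.prod_pos fun l _ => bCoeff_pos _ _ _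
  rw [h1 γ, h1 (_ * γ), h2, Real.sqrt_mul (bCoeff_pos _ _ _).le,
    Real.sqrt_mul (bCoeff_pos _ _ _).le, mul_div_mul_right _ _ (by positivity), Pi.mul_apply,
    Pi.mulSingle_eq_same]
  rfl

variable {H} [CompleteSpace H]

theorem adjoint_polyShift_apply (β γ : ∀ i, FreeMonoid (Fin (n i))) (x : PolyFock n H) :
    ContinuousLinearMap.adjoint (polyShift f m H β) x γ
      = ((√(polyCoeff f m γ) / √(polyCoeff f m (β * γ)) : ℝ) : ℂ) • x (β * γ) :=
  adjoint_weightedShift_apply _ _ _ _ _ _ _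

/-- The weights are quotients of consecutive values of `√(polyCoeff f m ·)`, so they telescope along
a product. -/
theorem adjoint_polyShift_mul_apply (β γ : ∀ i, FreeMonoid (Fin (n i))) (x : PolyFock n H) :
    ContinuousLinearMap.adjoint (polyShift f m H (β * γ)) x
      = ContinuousLinearMap.adjoint (polyShift f m H γ)
          (ContinuousLinearMap.adjoint (polyShift f m H β) x) := by
  ext δ
  simp only [adjoint_polyShift_apply, smul_smul, ← Complex.ofReal_mul, mul_assoc]
  congr 2
  have := polyCoeff_pos f m (γ * δ)
  rw [div_mul_div_cancel₀ (by positivity)]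

theorem polyShift_mul (β γ : ∀ i, FreeMonoid (Fin (n i))) :
    polyShift f m H (β * γ) = polyShift f m H β ∘L polyShift f m H γ := by
  apply ContinuousLinearMap.adjoint.injective
  rw [ContinuousLinearMap.adjoint_comp]
  ext1 x
  exact adjoint_polyShift_mul_apply f m β γ x

theorem polyShift_one : polyShift f m H 1 = ContinuousLinearMap.id ℂ (PolyFock n H) := by
  apply ContinuousLinearMap.adjoint.injective
  ext x γ
  have := polyCoeff_pos f m γ
  rw [adjoint_polyShift_apply, one_mul, div_self (by positivity), ContinuousLinearMap.adjoint_id]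
  simp

theorem lift_model (i : Fin k) (α : FreeMonoid (Fin (n i))) :
    FreeMonoid.lift (model f m H i) α = polyShift f m H (Pi.mulSingle i α) := by
  induction α using FreeMonoid.inductionOn' with
  | one => rw [map_one, Pi.mulSingle_one, polyShift_one]; rfl
  | of_mul j α ih =>
    rw [map_mul, FreeMonoid.lift_eval_of, ih, model_eq_polyShift, Pi.mulSingle_mul, polyShift_mul]
    rfl

theorem IsFinsupp.adjoint_polyShift {x : PolyFock n H} (hx : IsFinsupp x)
    (β : ∀ i, FreeMonoid (Fin (n i))) :
    IsFinsupp (ContinuousLinearMap.adjoint (polyShift f m H β) x) := by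
  refine (hx.preimage (mul_right_injective β).injOn).subset fun γ hγ h0 => hγ ?_
  rw [adjoint_polyShift_apply]
  change _ • x (β * γ) = 0
  have h0' : x (β * γ) = 0 := h0
  rw [h0', smul_zero]

theorem finite_left_divisors {N : ℕ} (δ : FreeMonoid (Fin N)) :
    {β : FreeMonoid (Fin N) | ∃ γ, β * γ = δ}.Finite := by
  refine ((Finset.range (δ.toList.length + 1)).finite_toSet.image
    fun s => FreeMonoid.ofList (δ.toList.take s)).subset ?_
  rintro β ⟨γ, rfl⟩
  refine ⟨β.toList.length, ?_, ?_⟩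
  · simp only [Finset.coe_range, Set.mem_Iio, FreeMonoid.toList_mul, List.length_append]
    omega
  · simp [FreeMonoid.toList_mul]

/-- The vector `W_β^* x` only sees the entries `x (β * γ)`, so `β` must consist of prefixes of a
point of the support, and a word has finitely many prefixes. -/
theorem IsFinsupp.finite_adjoint_ne_zero {x : PolyFock n H} (hx : IsFinsupp x) :
    {β | ContinuousLinearMap.adjoint (polyShift f m H β) x ≠ 0}.Finite := by
  have h : (⋃ δ ∈ Function.support (x : (∀ i, FreeMonoid (Fin (n i))) → H),
      Set.univ.pi fun i => {β : FreeMonoid (Fin (n i)) | ∃ γ, β * γ = δ i}).Finite :=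
    hx.biUnion fun δ _ => Set.Finite.pi fun i => finite_left_divisors (δ i)
  refine h.subset fun β hβ => ?_
  by_contra hc
  refine hβ ?_
  ext γ
  rw [adjoint_polyShift_apply]
  have : x (β * γ) = 0 := by
    by_contra h0
    refine hc (Set.mem_biUnion (x := β * γ) h0 ?_)
    intro i _
    exact ⟨γ i, rfl⟩
  rw [this, smul_zero]
  rfl

end PolyShift

/-! ### Weighted sums of a form along the backward shifts -/

section FormSum

variable {k : ℕ} {n : Fin k → ℕ}

/-- A tuple of words together with a splitting of its `i`-th word, versus the two parts. -/
def splitEquiv (i : Fin k) :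
    (Σ β : ∀ l, FreeMonoid (Fin (n l)), Fin ((β i).toList.length + 1)) ≃
      FreeMonoid (Fin (n i)) × (∀ l, FreeMonoid (Fin (n l))) :=
  Equiv.ofBijective
    (fun p => (FreeMonoid.ofList ((p.1 i).toList.take p.2),
      Function.update p.1 i (FreeMonoid.ofList ((p.1 i).toList.drop p.2)))) (by
    constructor
    · rintro ⟨β, s⟩ ⟨γ, t⟩ h
      obtain ⟨h1, h2⟩ := Prod.mk.inj h
      have h1' : (β i).toList.take s = (γ i).toList.take t := FreeMonoid.ofList.injective h1
      have h3 : (β i).toList.drop s = (γ i).toList.drop t := by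
        have := congrFun h2 i
        simpa using this
      have e : β = γ := by
        funext l
        by_cases hl : l = i
        · subst hl
          apply FreeMonoid.toList.injective
          rw [← List.take_append_drop s (β l).toList, h1', h3, List.take_append_drop]
        · simpa [hl] using congrFun h2 l
      subst e
      have h4 := congrArg List.length h1'
      simp only [List.length_take] at h4
      have := s.2
      have := t.2
      have : s = t := Fin.ext (by omega)
      rw [this]
    · rintro ⟨α, β⟩
      refine ⟨⟨Pi.mulSingle i α * β, ⟨α.toList.length, ?_⟩⟩, ?_⟩
      · simp only [Pi.mul_apply, Pi.mulSingle_eq_same, FreeMonoid.toList_mul, List.length_append]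
        omega
      · refine Prod.ext ?_ ?_
        · simp [FreeMonoid.toList_mul]
        · funext l
          by_cases hl : l = i
          · subst hl
            simp [FreeMonoid.toList_mul]
          · simp [hl])

theorem splitEquiv_apply (i : Fin k)
    (p : Σ β : ∀ l, FreeMonoid (Fin (n l)), Fin ((β i).toList.length + 1)) :
    splitEquiv i p = (FreeMonoid.ofList ((p.1 i).toList.take p.2),
      Function.update p.1 i (FreeMonoid.ofList ((p.1 i).toList.drop p.2))) :=
  rfl

theorem splitEquiv_fst_mul_snd (i : Fin k)
    (p : Σ β : ∀ l, FreeMonoid (Fin (n l)), Fin ((β i).toList.length + 1)) :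
    Pi.mulSingle i (splitEquiv i p).1 * (splitEquiv i p).2 = p.1 := by
  funext l
  by_cases hl : l = i
  · subst hl
    simp only [splitEquiv_apply, Pi.mul_apply, Pi.mulSingle_eq_same,
      Function.update_self, ← FreeMonoid.ofList_append, List.take_append_drop,
      FreeMonoid.ofList_toList]
  · simp [splitEquiv_apply, hl]

/-- A convolution of coefficients: the double sum is regrouped by the product word, each product
being counted once per cut position in its `i`-th word. Finite support of `G` justifies the
rearrangement. -/
theorem tsum_mul_tsum_mulSingle_mul (i : Fin k) (a : FreeMonoid (Fin (n i)) → ℝ)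
    (c : (∀ l, FreeMonoid (Fin (n l))) → ℝ) (G : (∀ l, FreeMonoid (Fin (n l))) → ℂ)
    (hG : (Function.support G).Finite) :
    ∑' α, (a α : ℂ) * ∑' β, (c β : ℂ) * G (Pi.mulSingle i α * β)
      = ∑' β, ((∑ s ∈ Finset.range ((β i).toList.length + 1),
          a (FreeMonoid.ofList ((β i).toList.take s)) *
            c (Function.update β i (FreeMonoid.ofList ((β i).toList.drop s))) : ℝ) : ℂ) * G β := by
  set F : FreeMonoid (Fin (n i)) × (∀ l, FreeMonoid (Fin (n l))) → ℂ :=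
    fun p => (a p.1 : ℂ) * ((c p.2 : ℂ) * G (Pi.mulSingle i p.1 * p.2)) with hF
  have hs : Summable (F ∘ splitEquiv i) := by
    refine summable_of_ne_finset_zero (s := hG.toFinset.sigma fun _ => Finset.univ) ?_
    intro p hp
    have h0 : G p.1 = 0 := by
      by_contra h
      exact hp (by simpa using h)
    simp only [hF, Function.comp, splitEquiv_fst_mul_snd, h0, mul_zero]
  have hs' : Summable F := (splitEquiv i).summable_iff.1 hs
  calc _ = ∑' α, ∑' β, F (α, β) := tsum_congr fun α => tsum_mul_left.symm
    _ = ∑' p, F p := hs'.tsum_prod.symm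
    _ = ∑' p, F (splitEquiv i p) := ((splitEquiv i).tsum_eq F).symm
    _ = ∑' β, ∑' s, F (splitEquiv i ⟨β, s⟩) := hs.tsum_sigma
    _ = _ := by
      refine tsum_congr fun β => ?_
      rw [tsum_fintype, Complex.ofReal_sum, Finset.sum_mul, Finset.sum_range]
      refine Finset.sum_congr rfl fun s _ => ?_
      simp only [hF, splitEquiv_fst_mul_snd]
      simp only [splitEquiv_apply, Complex.ofReal_mul, mul_assoc]

variable (f : ∀ i, PositiveRegular (n i)) (m : Fin k → ℕ)
  {H : Type u} [NormedAddCommGroup H] [InnerProductSpace ℂ H] [CompleteSpace H]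

theorem polyPow_update_succ (r : Fin k → ℕ) (i : Fin k) (β : ∀ l, FreeMonoid (Fin (n l))) :
    polyPow f (Function.update r i (r i + 1)) β = polyPow f r β +
      ∑ s ∈ Finset.range ((β i).toList.length + 1),
        (f i).coeff (FreeMonoid.ofList ((β i).toList.take s)) *
          polyPow f (Function.update r i (r i + 1))
            (Function.update β i (FreeMonoid.ofList ((β i).toList.drop s))) := by
  have h1 : ∀ (t : Fin k → ℕ) (γ : ∀ l, FreeMonoid (Fin (n l))), polyPow f t γ =
      bPow (f i).coeff (t i) (γ i) *
        ∏ l ∈ Finset.univ.erase i, bPow (f l).coeff (t l) (γ l) := fun t γ =>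
    (Finset.mul_prod_erase _ (fun l => bPow (f l).coeff (t l) (γ l)) (Finset.mem_univ i)).symm
  have h2 : ∀ (t : ℕ) (δ : FreeMonoid (Fin (n i))),
      ∏ l ∈ Finset.univ.erase i, bPow (f l).coeff (Function.update r i t l)
        (Function.update β i δ l) = ∏ l ∈ Finset.univ.erase i, bPow (f l).coeff (r l) (β l) := by
    intro t δ
    refine Finset.prod_congr rfl fun l hl => ?_
    have hne := (Finset.mem_erase.1 hl).1
    rw [Function.update_of_ne hne, Function.update_of_ne hne]
  have h3 := h2 (r i + 1) (β i)
  rw [Function.update_eq_self] at h3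
  simp only [h1, h2, h3, Function.update_self]
  rw [bPow_succ (f i).coeff_one, add_mul, Finset.sum_mul]
  simp only [mul_assoc]

/-- `∑_β c_β Q(W_β^* x)` -/
def formSum (c : (∀ i, FreeMonoid (Fin (n i))) → ℝ) (Q : PolyFock n H → ℂ) (x : PolyFock n H) : ℂ :=
  ∑' β, (c β : ℂ) * Q (ContinuousLinearMap.adjoint (polyShift f m H β) x)

/-- `∑_α a_{i,α} Q(W_{i,α}^* x)` -/
def formPhi (i : Fin k) (Q : PolyFock n H → ℂ) (x : PolyFock n H) : ℂ :=
  ∑' α, ((f i).coeff α : ℂ) *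
    Q (ContinuousLinearMap.adjoint (polyShift f m H (Pi.mulSingle i α)) x)

variable {f m}

theorem IsFinsupp.finite_form {x : PolyFock n H} (hx : IsFinsupp x) {Q : PolyFock n H → ℂ}
    (hQ : Q 0 = 0) : (Function.support fun β =>
      Q (ContinuousLinearMap.adjoint (polyShift f m H β) x)).Finite := by
  refine (hx.finite_adjoint_ne_zero f m).subset fun β hβ h0 => hβ ?_
  simp only [h0, hQ]

theorem IsFinsupp.summable_formSum {x : PolyFock n H} (hx : IsFinsupp x) {Q : PolyFock n H → ℂ}
    (hQ : Q 0 = 0) (c : (∀ i, FreeMonoid (Fin (n i))) → ℝ) : Summable fun β =>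
      (c β : ℂ) * Q (ContinuousLinearMap.adjoint (polyShift f m H β) x) := by
  refine summable_of_hasFiniteSupport ((hx.finite_form hQ (f := f) (m := m)).subset ?_)
  exact fun β hβ h0 => hβ (by simp only [h0, mul_zero])

theorem IsFinsupp.summable_formPhi {x : PolyFock n H} (hx : IsFinsupp x) {Q : PolyFock n H → ℂ}
    (hQ : Q 0 = 0) (i : Fin k) : Summable fun α => ((f i).coeff α : ℂ) *
      Q (ContinuousLinearMap.adjoint (polyShift f m H (Pi.mulSingle i α)) x) := by
  refine summable_of_hasFiniteSupport (((hx.finite_form hQ (f := f) (m := m)).preimage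
    (Pi.mulSingle_injective i).injOn).subset ?_)
  exact fun β hβ h0 => hβ (mul_eq_zero_of_right _ h0)

theorem formSum_zero (c : (∀ i, FreeMonoid (Fin (n i))) → ℝ) {Q : PolyFock n H → ℂ}
    (hQ : Q 0 = 0) : formSum f m c Q 0 = 0 := by
  simp [formSum, hQ]

theorem formSum_sub_formPhi {x : PolyFock n H} (hx : IsFinsupp x) {Q : PolyFock n H → ℂ}
    (hQ : Q 0 = 0) (r : Fin k → ℕ) (i : Fin k) :
    formSum f m (polyPow f (Function.update r i (r i + 1))) Q x
      - formPhi f m i (formSum f m (polyPow f (Function.update r i (r i + 1))) Q) x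
      = formSum f m (polyPow f r) Q x := by
  have h := tsum_mul_tsum_mulSingle_mul i (f i).coeff
    (polyPow f (Function.update r i (r i + 1))) _ (hx.finite_form hQ (f := f) (m := m))
  simp only [adjoint_polyShift_mul_apply] at h
  unfold formPhi formSum
  rw [h, sub_eq_iff_eq_add]
  have hs := hx.summable_formSum hQ (f := f) (m := m)
  rw [← (hs _).tsum_add (hs _)]
  refine tsum_congr fun β => ?_
  rw [← add_mul, ← Complex.ofReal_add, polyPow_update_succ]

/-- Since `a_{i,1} = 0`, the right-hand side evaluates `Q` only at `W_{i,α}^* x` with `α` nonempty,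
and these vectors are annihilated by shorter words than `x` is. Induction on that length ends at `x
= 0`. -/
theorem form_eq_zero_of_eq_formPhi (i : Fin k) {Q : PolyFock n H → ℂ} (hQ : Q 0 = 0)
    (h : ∀ x, IsFinsupp x → Q x = formPhi f m i Q x) {x : PolyFock n H} (hx : IsFinsupp x) :
    Q x = 0 := by
  have key : ∀ N : ℕ, ∀ x : PolyFock n H, IsFinsupp x →
      (∀ α : FreeMonoid (Fin (n i)), N ≤ α.toList.length →
        ContinuousLinearMap.adjoint (polyShift f m H (Pi.mulSingle i α)) x = 0) → Q x = 0 := by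
    intro N
    induction N with
    | zero =>
      intro x _ hN
      have := hN 1 (Nat.zero_le _)
      rw [Pi.mulSingle_one, polyShift_one, ContinuousLinearMap.adjoint_id] at this
      rw [show x = 0 from this, hQ]
    | succ N ih =>
      intro x hx hN
      rw [h x hx]
      refine (tsum_congr fun α => ?_).trans tsum_zero
      by_cases hα : α = 1
      · rw [hα, (f i).coeff_one, Complex.ofReal_zero, zero_mul]
      · refine mul_eq_zero_of_right _ (ih _ (hx.adjoint_polyShift f m _) fun γ hγ => ?_)
        rw [← adjoint_polyShift_mul_apply, ← Pi.mulSingle_mul]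
        refine hN _ ?_
        have : α.toList.length ≠ 0 := fun h0 =>
          hα (FreeMonoid.toList.injective (List.eq_nil_of_length_eq_zero h0))
        rw [FreeMonoid.toList_mul, List.length_append]
        omega
  have hfin := (hx.finite_adjoint_ne_zero f m).preimage
    (Pi.mulSingle_injective (M := fun l => FreeMonoid (Fin (n l))) i).injOn
  obtain ⟨N, hN⟩ := (hfin.image fun α => α.toList.length).bddAbove
  refine key (N + 1) x hx fun α hα => ?_
  by_contra h0
  have := hN ⟨α, h0, rfl⟩
  simp only at this
  omega

/-- The backward direction is `formSum_sub_formPhi`. Forward, `Q` and the proposed sum have the same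
image under `id - Φ_i`, so the injectivity lemma applies to their difference. -/
theorem formSum_update_succ_iff (i : Fin k) {P Q Q' : PolyFock n H → ℂ} (hP : P 0 = 0)
    (hQ : Q 0 = 0) (h : ∀ x, IsFinsupp x → Q' x = Q x - formPhi f m i Q x) (r : Fin k → ℕ) :
    (∀ x, IsFinsupp x → Q' x = formSum f m (polyPow f r) P x) ↔
      ∀ x, IsFinsupp x →
        Q x = formSum f m (polyPow f (Function.update r i (r i + 1))) P x := by
  set G := formSum f m (polyPow f (Function.update r i (r i + 1))) P with hG
  have hG0 : G 0 = 0 := formSum_zero _ hP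
  constructor
  · intro h1 x hx
    refine sub_eq_zero.1 (form_eq_zero_of_eq_formPhi (f := f) (m := m) i
      (Q := fun x => Q x - G x) (by simp [hQ, hG0]) ?_ hx)
    intro x hx
    have e : formPhi f m i (fun x => Q x - G x) x = formPhi f m i Q x - formPhi f m i G x := by
      unfold formPhi
      rw [← (hx.summable_formPhi hQ i).tsum_sub (hx.summable_formPhi hG0 i)]
      simp only [mul_sub]
    have h2 := formSum_sub_formPhi (f := f) (m := m) hx hP r i
    rw [← h1 x hx, h x hx] at h2
    rw [e]
    linear_combination -h2
  · intro h1 x hx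
    rw [← formSum_sub_formPhi hx hP r i, h x hx, h1 x hx]
    congr 1
    exact tsum_congr fun α => by rw [h1 _ (hx.adjoint_polyShift f m _)]

end FormSum

/-! ### Column operators -/

section Column

variable {ι : Type v} {K : Type u} [NormedAddCommGroup K] [InnerProductSpace ℂ K]
  {E : Type u} [NormedAddCommGroup E] [InnerProductSpace ℂ E]

/-- A square summable family of operators is the family of entries of a bounded operator into
`ℓ²`. -/
theorem exists_column (T : ι → K →L[ℂ] E) {C : ℝ} (hC : 0 ≤ C)
    (hT : ∀ (s : Finset ι) (x : K), ∑ a ∈ s, ‖T a x‖ ^ 2 ≤ C ^ 2 * ‖x‖ ^ 2) :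
    ∃ R : K →L[ℂ] lp (fun _ : ι => E) 2, ∀ x a, R x a = T a x := by
  have hmem : ∀ x, Memℓp (E := fun _ : ι => E) (fun a => T a x) 2 := by
    intro x
    refine memℓp_gen ?_
    simpa using summable_of_sum_le (fun a => sq_nonneg ‖T a x‖) fun s => hT s x
  let R : K →ₗ[ℂ] lp (fun _ : ι => E) 2 :=
    { toFun := fun x => ⟨fun a => T a x, hmem x⟩
      map_add' := by
        intro x y
        ext a
        exact map_add (T a) x y
      map_smul' := by
        intro c x
        ext a
        exact map_smul (T a) c x }
  refine ⟨R.mkContinuous C fun x => ?_, fun x a => rfl⟩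
  refine abs_le_of_sq_le_sq' ?_ (by positivity) |>.2
  rw [mul_pow, norm_sq_eq]
  exact Real.tsum_le_of_sum_le (fun a => sq_nonneg _) fun s => hT s x

end Column

/-! ### The maps `Φ_{f,X}` for row contractions -/

section Phi

variable {K : Type u} [NormedAddCommGroup K] [InnerProductSpace ℂ K] [CompleteSpace K]
  {N : ℕ} (f : PositiveRegular N) (X : Fin N → K →L[ℂ] K)

/-- `Φ_{f,X}(I) ≤ I`, in terms of the finite partial sums. -/
def IsRowContraction : Prop :=
  ∀ (s : Finset (FreeMonoid (Fin N))) (x : K),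
    ∑ α ∈ s, f.coeff α * ‖ContinuousLinearMap.adjoint (FreeMonoid.lift X α) x‖ ^ 2 ≤ ‖x‖ ^ 2

variable {f X}

/-- The limit is `R^* S` for the columns `R = (√a_α X_α^*)` and `S = (√a_α Y X_α^*)`, both bounded
by the row contraction inequality. Convergence of the matrix entries is unconditional. -/
theorem IsRowContraction.exists_hasSum (h : IsRowContraction f X) (Y : K →L[ℂ] K) :
    ∃ L : K →L[ℂ] K, ∀ x y : K, HasSum (fun α => (f.coeff α : ℂ) *
      inner ℂ (ContinuousLinearMap.adjoint (FreeMonoid.lift X α) x)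
        (Y (ContinuousLinearMap.adjoint (FreeMonoid.lift X α) y))) (inner ℂ x (L y)) := by
  have hsq : ∀ α, √(f.coeff α) ^ 2 = f.coeff α := fun α => Real.sq_sqrt (f.coeff_nonneg α)
  have hn : ∀ α (z : K), ‖((√(f.coeff α) : ℝ) : ℂ) • z‖ ^ 2 = f.coeff α * ‖z‖ ^ 2 := by
    intro α z
    rw [norm_smul, mul_pow, Complex.norm_real, Real.norm_eq_abs, sq_abs, hsq]
  obtain ⟨R, hR⟩ := exists_column
    (fun α => ((√(f.coeff α) : ℝ) : ℂ) • ContinuousLinearMap.adjoint (FreeMonoid.lift X α))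
    zero_le_one (by
      intro s x
      simp only [smul_apply, hn, one_pow, one_mul]
      exact h s x)
  obtain ⟨S, hS⟩ := exists_column
    (fun α => ((√(f.coeff α) : ℝ) : ℂ) •
      (Y ∘L ContinuousLinearMap.adjoint (FreeMonoid.lift X α)))
    (norm_nonneg Y) (by
      intro s x
      simp only [smul_apply, hn, ContinuousLinearMap.comp_apply]
      refine le_trans ?_ (mul_le_mul_of_nonneg_left (h s x) (sq_nonneg ‖Y‖))
      rw [Finset.mul_sum]
      refine Finset.sum_le_sum fun α _ => ?_
      rw [mul_left_comm]
      refine mul_le_mul_of_nonneg_left ?_ (f.coeff_nonneg α)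
      rw [← mul_pow]
      exact pow_le_pow_left₀ (norm_nonneg _) (Y.le_opNorm _) 2)
  refine ⟨ContinuousLinearMap.adjoint R ∘L S, fun x y => ?_⟩
  rw [ContinuousLinearMap.comp_apply, ContinuousLinearMap.adjoint_inner_right]
  refine (lp.hasSum_inner (𝕜 := ℂ) (R x) (S y)).congr_fun ?_
  intro α
  rw [hR, hS]
  simp only [smul_apply, ContinuousLinearMap.comp_apply, inner_smul_left,
    inner_smul_right, Complex.conj_ofReal]
  rw [← mul_assoc, ← Complex.ofReal_mul, Real.mul_self_sqrt (f.coeff_nonneg α)]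

/-- Passes from the unconditional sum over all words to summation by length, which starts at length
one; the empty word is dropped by `g 1 = 0`. -/
theorem tendsto_sum_words {g : FreeMonoid (Fin N) → ℂ} (h1 : g 1 = 0) {S : ℂ} (h : HasSum g S) :
    Tendsto (fun q : ℕ => ∑ l ∈ Finset.Icc 1 q, ∑ w : Fin l → Fin N,
      g (FreeMonoid.ofList (List.ofFn w))) atTop (𝓝 S) := by
  have h2 : HasSum (fun p : Σ l, Fin l → Fin N => g (FreeMonoid.ofList (List.ofFn p.2))) S :=
    (List.equivSigmaTuple.symm.trans FreeMonoid.ofList).hasSum_iff.2 h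
  have h3 := (h2.sigma fun l => hasSum_fintype _).tendsto_sum_nat
  refine ((tendsto_add_atTop_iff_nat 1).2 h3).congr fun q => ?_
  rw [Finset.range_eq_Ico, Finset.sum_eq_sum_Ico_succ_bot (Nat.succ_pos q)]
  have e0 : ∑ w : Fin 0 → Fin N, g (FreeMonoid.ofList (List.ofFn w)) = 0 :=
    Finset.sum_eq_zero fun w _ => by rw [List.ofFn_zero]; exact h1
  rw [e0, zero_add]
  rfl

theorem tendsto_phiPartialSum {Y L : K →L[ℂ] K}
    (hL : ∀ x y : K, HasSum (fun α => (f.coeff α : ℂ) *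
      inner ℂ (ContinuousLinearMap.adjoint (FreeMonoid.lift X α) x)
        (Y (ContinuousLinearMap.adjoint (FreeMonoid.lift X α) y))) (inner ℂ x (L y))) :
    Tendsto (fun q : ℕ =>
      (ContinuousLinearMapWOT.ofCLM (phiPartialSum f X Y q) : K →WOT[ℂ] K)) atTop
      (𝓝 (ContinuousLinearMapWOT.ofCLM L)) := by
  rw [ContinuousLinearMapWOT.tendsto_iff_forall_inner_apply_tendsto]
  intro y x
  refine (tendsto_sum_words (by rw [f.coeff_one]; simp) (hL x y)).congr fun q => ?_
  simp only [ContinuousLinearMapWOT.ofCLM_apply, phiPartialSum, sum_apply,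
    inner_sum, smul_apply, ContinuousLinearMap.comp_apply, inner_smul_right,
    ContinuousLinearMap.adjoint_inner_left]

theorem phi_eq {Y L : K →L[ℂ] K}
    (hL : ∀ x y : K, HasSum (fun α => (f.coeff α : ℂ) *
      inner ℂ (ContinuousLinearMap.adjoint (FreeMonoid.lift X α) x)
        (Y (ContinuousLinearMap.adjoint (FreeMonoid.lift X α) y))) (inner ℂ x (L y))) :
    phi f X Y = L := by
  unfold phi
  rw [(tendsto_phiPartialSum hL).limUnder_eq]

theorem IsRowContraction.hasSum_inner_phi (h : IsRowContraction f X) (Y : K →L[ℂ] K) (x y : K) :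
    HasSum (fun α => (f.coeff α : ℂ) *
      inner ℂ (ContinuousLinearMap.adjoint (FreeMonoid.lift X α) x)
        (Y (ContinuousLinearMap.adjoint (FreeMonoid.lift X α) y))) (inner ℂ x (phi f X Y y)) := by
  obtain ⟨L, hL⟩ := h.exists_hasSum Y
  rw [phi_eq hL]
  exact hL x y

end Phi

/-! ### The model is a tuple of row contractions -/

section Model

variable {k : ℕ} {n : Fin k → ℕ} {f : ∀ i, PositiveRegular (n i)} {m : Fin k → ℕ}
  {H : Type u} [NormedAddCommGroup H] [InnerProductSpace ℂ H] [CompleteSpace H]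

theorem polyCoeff_mul_norm_sq (β : ∀ i, FreeMonoid (Fin (n i))) (x : PolyFock n H) :
    polyCoeff f m β * ‖ContinuousLinearMap.adjoint (polyShift f m H β) x 1‖ ^ 2 = ‖x β‖ ^ 2 := by
  have hb := polyCoeff_pos f m β
  rw [adjoint_polyShift_apply, polyCoeff_one, mul_one, norm_smul, mul_pow, Complex.norm_real,
    Real.norm_eq_abs, sq_abs, div_pow, Real.sqrt_one, one_pow, Real.sq_sqrt hb.le, ← mul_assoc,
    mul_one_div_cancel hb.ne', one_mul]

/-- The entry of `W_β^* x` at the empty tuple is `x β / √b_β`, so the coefficients `b_β` exactly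
undo the weights. In effect the identity operator has the form with exponent `m`. -/
theorem norm_sq_eq_formSum (hm : ∀ i, 1 ≤ m i) (x : PolyFock n H) :
    ((‖x‖ ^ 2 : ℝ) : ℂ) = formSum f m (polyPow f m) (fun y => ((‖y 1‖ ^ 2 : ℝ) : ℂ)) x := by
  unfold formSum
  rw [norm_sq_eq, Complex.ofReal_tsum]
  refine tsum_congr fun β => ?_
  rw [polyPow_eq_polyCoeff f m hm, ← Complex.ofReal_mul, polyCoeff_mul_norm_sq]

/-- Subtracting the `Φ_i`-form from `‖x‖²` lowers the exponent from `m` to `m - e_i`, where the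
coefficients are still nonnegative. -/
theorem isRowContraction_model (hm : ∀ i, 1 ≤ m i) (i : Fin k) :
    IsRowContraction (f i) (model f m H i) := by
  intro s x
  refine IsFinsupp.dense.induction (P := fun x => ∑ α ∈ s, (f i).coeff α *
    ‖ContinuousLinearMap.adjoint (FreeMonoid.lift (model f m H i) α) x‖ ^ 2 ≤ ‖x‖ ^ 2) ?_ ?_ x
  · intro x hx
    simp only [lift_model]
    set P : PolyFock n H → ℂ := fun y => ((‖y 1‖ ^ 2 : ℝ) : ℂ) with hP
    set Q : PolyFock n H → ℂ := fun y => ((‖y‖ ^ 2 : ℝ) : ℂ) with hQ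
    have hP0 : P 0 = 0 := by simp [hP]
    have hQ0 : Q 0 = 0 := by simp [hQ]
    have h1 := formSum_sub_formPhi (f := f) (m := m) hx hP0 (Function.update m i (m i - 1)) i
    have e : Function.update (Function.update m i (m i - 1)) i
        (Function.update m i (m i - 1) i + 1) = m := by
      rw [Function.update_self, Function.update_idem, Nat.sub_add_cancel (hm i),
        Function.update_eq_self]
    have e2 : formSum f m (polyPow f m) P = Q := by
      funext y
      exact (norm_sq_eq_formSum hm y).symm
    rw [e, e2] at h1
    have hs := hx.summable_formPhi (f := f) (m := m) hQ0 i
    simp only [formPhi, formSum, hQ, hP, ← Complex.ofReal_mul, ← Complex.ofReal_tsum,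
      ← Complex.ofReal_sub, Complex.ofReal_inj] at h1
    simp only [hQ, ← Complex.ofReal_mul, Complex.summable_ofReal] at hs
    refine (hs.sum_le_tsum s fun α _ => mul_nonneg ((f i).coeff_nonneg α) (sq_nonneg _)).trans ?_
    rw [← sub_nonneg, h1]
    exact tsum_nonneg fun β => mul_nonneg (polyPow_nonneg f _ β) (sq_nonneg _)
  · refine isClosed_le ?_ (by fun_prop)
    fun_prop

theorem hasSum_inner_phi_model (hm : ∀ i, 1 ≤ m i) (i : Fin k)
    (Y : PolyFock n H →L[ℂ] PolyFock n H) (x y : PolyFock n H) :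
    HasSum (fun α => ((f i).coeff α : ℂ) *
      inner ℂ (ContinuousLinearMap.adjoint (polyShift f m H (Pi.mulSingle i α)) x)
        (Y (ContinuousLinearMap.adjoint (polyShift f m H (Pi.mulSingle i α)) y)))
      (inner ℂ x (phi (f i) (model f m H i) Y y)) := by
  simpa only [lift_model] using (isRowContraction_model hm i).hasSum_inner_phi Y x y

end Model

/-! ### Forms of defect operators -/

theorem isPositive_of_finsupp {k : ℕ} {n : Fin k → ℕ} {H : Type u} [NormedAddCommGroup H]
    [InnerProductSpace ℂ H] {Z : PolyFock n H →L[ℂ] PolyFock n H}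
    (h : ∀ x, IsFinsupp x → ∃ c : ℝ, 0 ≤ c ∧ inner ℂ x (Z x) = (c : ℂ)) : Z.IsPositive := by
  have key : ∀ x : PolyFock n H, 0 ≤ (inner ℂ x (Z x)).re ∧ (inner ℂ x (Z x)).im = 0 := by
    intro x
    refine IsFinsupp.dense.induction (P := fun x : PolyFock n H =>
      0 ≤ (inner ℂ x (Z x)).re ∧ (inner ℂ x (Z x)).im = 0) ?_ ?_ x
    · intro x hx
      obtain ⟨c, hc, e⟩ := h x hx
      rw [e]
      exact ⟨hc, Complex.ofReal_im c⟩
    · have hc : Continuous fun x : PolyFock n H => (inner ℂ x (Z x) : ℂ) := by fun_prop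
      have h1 : IsClosed {x : PolyFock n H | 0 ≤ (inner ℂ x (Z x)).re} :=
        isClosed_le continuous_const (Complex.continuous_re.comp hc)
      have h2 : IsClosed {x : PolyFock n H | (inner ℂ x (Z x)).im = 0} :=
        isClosed_eq (Complex.continuous_im.comp hc) continuous_const
      exact h1.inter h2
  rw [ContinuousLinearMap.isPositive_iff_complex]
  intro x
  obtain ⟨h1, h2⟩ := key x
  have e : inner ℂ (Z x) x = ((inner ℂ x (Z x)).re : ℂ) := by
    rw [← inner_conj_symm (Z x) x]
    apply Complex.ext
    · rw [Complex.conj_re, Complex.ofReal_re]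
    · rw [Complex.conj_im, h2, neg_zero, Complex.ofReal_im]
  rw [e]
  simpa using h1

section DefectForm

variable {k : ℕ} {n : Fin k → ℕ} (f : ∀ i, PositiveRegular (n i)) (m : Fin k → ℕ)
  {H : Type u} [NormedAddCommGroup H] [InnerProductSpace ℂ H] [CompleteSpace H]

/-- On finitely supported vectors, the quadratic form of `Z` is `∑_β b^{(r)}_β P(W_β^* x)`, where
`b^{(r)}` are the coefficients of `∏ i, (1 - f_i)^{-r_i}`. -/
def HasForm (P : PolyFock n H → ℂ) (r : Fin k → ℕ) (Z : PolyFock n H →L[ℂ] PolyFock n H) : Prop :=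
  ∀ x, IsFinsupp x → inner ℂ x (Z x) = formSum f m (polyPow f r) P x

variable {f m}

theorem hasForm_sub_phi (hm : ∀ i, 1 ≤ m i) {P : PolyFock n H → ℂ} (hP : P 0 = 0)
    (r : Fin k → ℕ) (i : Fin k) (Z : PolyFock n H →L[ℂ] PolyFock n H) :
    HasForm f m P r (Z - phi (f i) (model f m H i) Z) ↔ HasForm f m P (r + Pi.single i 1) Z := by
  have e : r + Pi.single i 1 = Function.update r i (r i + 1) := by
    funext l
    by_cases hl : l = i
    · subst hl
      simp
    · simp [hl]
  rw [e]
  refine formSum_update_succ_iff (f := f) (m := m) i hP (Q := fun x => inner ℂ x (Z x))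
    (Q' := fun x => inner ℂ x ((Z - phi (f i) (model f m H i) Z) x)) (by simp) ?_ r
  intro x _
  simp only [sub_apply, inner_sub_right]
  rw [formPhi, (hasSum_inner_phi_model hm i Z x x).tsum_eq]

theorem hasForm_iterate_sub_phi (hm : ∀ i, 1 ≤ m i) {P : PolyFock n H → ℂ} (hP : P 0 = 0)
    (i : Fin k) (q : ℕ) (r : Fin k → ℕ) (Z : PolyFock n H →L[ℂ] PolyFock n H) :
    HasForm f m P r ((fun Z' => Z' - phi (f i) (model f m H i) Z')^[q] Z) ↔
      HasForm f m P (r + Pi.single i q) Z := by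
  induction q generalizing r with
  | zero => simp
  | succ q ih =>
    rw [Function.iterate_succ_apply', hasForm_sub_phi hm hP, ih, add_assoc, ← Pi.single_add,
      add_comm 1 q]

/-- Each factor `id - Φ_i` shifts the exponent by `e_i`, and the shifts add up to `p`; no
commutation of the maps `Φ_i` is needed. -/
theorem hasForm_defect (hm : ∀ i, 1 ≤ m i) {P : PolyFock n H → ℂ} (hP : P 0 = 0)
    (p r : Fin k → ℕ) (Y : PolyFock n H →L[ℂ] PolyFock n H) :
    HasForm f m P r (defect f (model f m H) p Y) ↔ HasForm f m P (r + p) Y := by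
  have key : ∀ (l : List (Fin k)) (r : Fin k → ℕ),
      HasForm f m P r (l.foldr
        (fun i Z => (fun Z' => Z' - phi (f i) (model f m H i) Z')^[p i] Z) Y) ↔
      HasForm f m P (r + (l.map fun i => Pi.single i (p i)).sum) Y := by
    intro l
    induction l with
    | nil => simp
    | cons i l ih =>
      intro r
      rw [List.foldr_cons, hasForm_iterate_sub_phi hm hP, ih, List.map_cons, List.sum_cons,
        add_assoc]
  rw [defect, Fin.foldr_eq_foldr_finRange, key, ← Fin.sum_univ_def, Finset.univ_sum_single]

theorem HasForm.isPositive {Q : PolyFock n H → ℝ} (hQ : ∀ x, 0 ≤ Q x) {r : Fin k → ℕ}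
    {Z : PolyFock n H →L[ℂ] PolyFock n H} (h : HasForm f m (fun x => (Q x : ℂ)) r Z) :
    Z.IsPositive := by
  refine isPositive_of_finsupp fun x hx =>
    ⟨∑' β, polyPow f r β * Q (ContinuousLinearMap.adjoint (polyShift f m H β) x), ?_, ?_⟩
  · exact tsum_nonneg fun β => mul_nonneg (polyPow_nonneg f r β) (hQ _)
  · rw [h x hx, formSum, Complex.ofReal_tsum]
    simp only [Complex.ofReal_mul]

end DefectForm

/-! ### Factorization through multi-analytic operators -/

section Factorization

variable {k : ℕ} {n : Fin k → ℕ} {f : ∀ i, PositiveRegular (n i)} {m : Fin k → ℕ}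

theorem exists_eq_adjoint_comp_self {K : Type u} [NormedAddCommGroup K] [InnerProductSpace ℂ K]
    [CompleteSpace K] {T : K →L[ℂ] K} (hT : T.IsPositive) :
    ∃ C : K →L[ℂ] K, T = ContinuousLinearMap.adjoint C ∘L C :=
  CStarAlgebra.nonneg_iff_eq_star_mul_self.1 ((ContinuousLinearMap.nonneg_iff_isPositive _).2 hT)

theorem norm_sq_smul_sqrt {c : ℝ} (hc : 0 ≤ c) {K : Type u} [NormedAddCommGroup K]
    [NormedSpace ℂ K] (x : K) :
    ‖((√c : ℝ) : ℂ) • x‖ ^ 2 = c * ‖x‖ ^ 2 := by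
  rw [norm_smul, mul_pow, Complex.norm_real, Real.norm_eq_abs, sq_abs, Real.sq_sqrt hc]

theorem tuple_induction {p : (∀ i, FreeMonoid (Fin (n i))) → Prop} (one : p 1)
    (mul : ∀ (i : Fin k) (j : Fin (n i)) (β : ∀ i, FreeMonoid (Fin (n i))), p β →
      p (Pi.mulSingle i (FreeMonoid.of j) * β)) (β : ∀ i, FreeMonoid (Fin (n i))) : p β := by
  generalize hN : ∑ i, (β i).toList.length = N
  induction N generalizing β with
  | zero =>
    have : β = 1 := by
      funext i
      have := Finset.sum_eq_zero_iff.1 hN i (Finset.mem_univ i)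
      exact FreeMonoid.toList.injective (List.eq_nil_of_length_eq_zero this)
    rw [this]
    exact one
  | succ N ih =>
    obtain ⟨i, -, hi⟩ := Finset.exists_ne_zero_of_sum_ne_zero (hN.trans_ne N.succ_ne_zero)
    obtain ⟨j, t, ht⟩ := List.exists_cons_of_length_pos (Nat.pos_of_ne_zero hi)
    have hβ : β = Pi.mulSingle i (FreeMonoid.of j)
        * Function.update β i (FreeMonoid.ofList t) := by
      funext l
      by_cases hl : l = i
      · subst hl
        apply FreeMonoid.toList.injective
        simp [FreeMonoid.toList_mul, ht]
      · simp [hl]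
    rw [hβ]
    refine mul i j _ (ih _ ?_)
    rw [← Finset.add_sum_erase _ _ (Finset.mem_univ i)] at hN ⊢
    have e : ∑ l ∈ Finset.univ.erase i,
        (Function.update β i (FreeMonoid.ofList t) l).toList.length
        = ∑ l ∈ Finset.univ.erase i, (β l).toList.length :=
      Finset.sum_congr rfl fun l hl => by
        rw [Function.update_of_ne (Finset.mem_erase.1 hl).1]
    rw [e, Function.update_self, FreeMonoid.toList_ofList]
    rw [ht, List.length_cons] at hN
    omega

variable {H : Type u} [NormedAddCommGroup H] [InnerProductSpace ℂ H] [CompleteSpace H]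
  {E : Type u} [NormedAddCommGroup E] [InnerProductSpace ℂ E] [CompleteSpace E]

theorem IsMultiAnalytic.comp_polyShift {A : PolyFock n E →L[ℂ] PolyFock n H}
    (hA : IsMultiAnalytic f m A) (β : ∀ i, FreeMonoid (Fin (n i))) :
    A ∘L polyShift f m E β = polyShift f m H β ∘L A := by
  induction β using tuple_induction with
  | one => rw [polyShift_one, polyShift_one]; rfl
  | mul i j β ih =>
    rw [polyShift_mul, polyShift_mul, ← ContinuousLinearMap.comp_assoc, ← model_eq_polyShift,
      ← model_eq_polyShift, hA, ContinuousLinearMap.comp_assoc, ih,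
      ContinuousLinearMap.comp_assoc]

/-- The adjoint of `A` intertwines the backward shifts, so this is `norm_sq_eq_formSum` at `A^* x`.
-/
theorem IsMultiAnalytic.hasForm (hm : ∀ i, 1 ≤ m i) {A : PolyFock n E →L[ℂ] PolyFock n H}
    (hA : IsMultiAnalytic f m A) :
    HasForm f m (fun x => ((‖ContinuousLinearMap.adjoint A x 1‖ ^ 2 : ℝ) : ℂ)) m
      (A ∘L ContinuousLinearMap.adjoint A) := by
  intro x _
  have e : ∀ β, ContinuousLinearMap.adjoint (polyShift f m E β) (ContinuousLinearMap.adjoint A x)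
      = ContinuousLinearMap.adjoint A (ContinuousLinearMap.adjoint (polyShift f m H β) x) := by
    intro β
    have := congrArg ContinuousLinearMap.adjoint (hA.comp_polyShift β)
    rw [ContinuousLinearMap.adjoint_comp, ContinuousLinearMap.adjoint_comp] at this
    exact congrArg (fun T : PolyFock n H →L[ℂ] PolyFock n E => T x) this
  rw [ContinuousLinearMap.comp_apply, ← ContinuousLinearMap.adjoint_inner_left,
    inner_self_eq_norm_sq_to_K]
  have := norm_sq_eq_formSum (f := f) hm (ContinuousLinearMap.adjoint A x)
  rw [formSum] at this
  simp only [e] at this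
  rw [formSum, ← this]
  norm_cast

theorem IsMultiAnalytic.isPositive_defect (hm : ∀ i, 1 ≤ m i)
    {A : PolyFock n E →L[ℂ] PolyFock n H} (hA : IsMultiAnalytic f m A) {p : Fin k → ℕ}
    (hp : p ≤ m) :
    (defect f (model f m H) p (A ∘L ContinuousLinearMap.adjoint A)).IsPositive := by
  refine HasForm.isPositive (f := f) (m := m) (r := m - p)
    (Q := fun x => ‖ContinuousLinearMap.adjoint A x 1‖ ^ 2) (fun x => sq_nonneg _) ?_
  rw [hasForm_defect hm (by simp), tsub_add_cancel_of_le hp]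
  exact hA.hasForm hm

theorem exists_isMultiAnalytic (hm : ∀ i, 1 ≤ m i) {Y : PolyFock n H →L[ℂ] PolyFock n H}
    (hY : (defect f (model f m H) m Y).IsPositive) :
    ∃ A : PolyFock n (PolyFock n H) →L[ℂ] PolyFock n H,
      IsMultiAnalytic f m A ∧ Y = A ∘L ContinuousLinearMap.adjoint A := by
  obtain ⟨C, hC⟩ := exists_eq_adjoint_comp_self hY
  have hform : HasForm f m (fun x => ((‖C x‖ ^ 2 : ℝ) : ℂ)) m Y := by
    -- At exponent zero only the empty tuple has a nonzero coefficient, so the sum is `‖C x‖²`.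
    have h0 : HasForm f m (fun x => ((‖C x‖ ^ 2 : ℝ) : ℂ)) 0 (defect f (model f m H) m Y) := by
      intro x _
      rw [formSum, tsum_eq_single 1 fun β hβ => by
          rw [polyPow_zero f β hβ, Complex.ofReal_zero, zero_mul],
        polyPow_one, Complex.ofReal_one, one_mul, polyShift_one, ContinuousLinearMap.adjoint_id,
        hC, ContinuousLinearMap.comp_apply,
        ContinuousLinearMap.adjoint_inner_right, inner_self_eq_norm_sq_to_K]
      norm_cast
    rwa [hasForm_defect hm (by simp), zero_add] at h0
  have hsum : ∀ x : PolyFock n H, IsFinsupp x → HasSum (fun β => polyCoeff f m β *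
      ‖C (ContinuousLinearMap.adjoint (polyShift f m H β) x)‖ ^ 2) (inner ℂ x (Y x)).re := by
    intro x hx
    have hs := hx.summable_formSum (f := f) (m := m)
      (Q := fun x => ((‖C x‖ ^ 2 : ℝ) : ℂ)) (by simp) (polyPow f m)
    have h1 := hs.hasSum_iff.2 (hform x hx).symm
    simpa only [polyPow_eq_polyCoeff f m hm, ← Complex.ofReal_mul, Complex.ofReal_re] using
      Complex.hasSum_re h1
  have hbound : ∀ (s : Finset (∀ i, FreeMonoid (Fin (n i)))) (x : PolyFock n H),
      ∑ β ∈ s, polyCoeff f m β *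
        ‖C (ContinuousLinearMap.adjoint (polyShift f m H β) x)‖ ^ 2 ≤ ‖Y‖ * ‖x‖ ^ 2 := by
    intro s x
    refine IsFinsupp.dense.induction (P := fun x : PolyFock n H => ∑ β ∈ s, polyCoeff f m β *
        ‖C (ContinuousLinearMap.adjoint (polyShift f m H β) x)‖ ^ 2 ≤ ‖Y‖ * ‖x‖ ^ 2) ?_ ?_ x
    · intro x hx
      refine (sum_le_hasSum s (fun β _ =>
        mul_nonneg (polyCoeff_pos f m β).le (sq_nonneg _)) (hsum x hx)).trans ?_
      refine (Complex.re_le_norm _).trans ((norm_inner_le_norm _ _).trans ?_)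
      have := mul_le_mul_of_nonneg_left (Y.le_opNorm x) (norm_nonneg x)
      nlinarith
    · refine isClosed_le ?_ (by fun_prop)
      fun_prop
  obtain ⟨B, hB⟩ := exists_column
    (fun β => ((√(polyCoeff f m β) : ℝ) : ℂ) •
      (C ∘L ContinuousLinearMap.adjoint (polyShift f m H β)))
    (Real.sqrt_nonneg ‖Y‖) (by
      intro s x
      simp only [smul_apply, ContinuousLinearMap.comp_apply]
      simp only [norm_sq_smul_sqrt (polyCoeff_pos f m _).le, Real.sq_sqrt (norm_nonneg Y)]
      exact hbound s x)
  simp only [smul_apply, ContinuousLinearMap.comp_apply] at hB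
  refine ⟨ContinuousLinearMap.adjoint B, ?_, ?_⟩
  · intro i j
    apply ContinuousLinearMap.adjoint.injective
    rw [ContinuousLinearMap.adjoint_comp, ContinuousLinearMap.adjoint_comp,
      ContinuousLinearMap.adjoint_adjoint, model_eq_polyShift, model_eq_polyShift]
    ext1 x
    ext1
    funext γ
    simp only [ContinuousLinearMap.comp_apply]
    -- The weight of the backward shift cancels the factor `√b` in the next entry of `B`, leaving
    -- `√b_γ` on both sides.
    have := polyCoeff_pos f m (Pi.mulSingle i (FreeMonoid.of j) * γ)
    rw [adjoint_polyShift_apply, hB, hB, smul_smul, ← Complex.ofReal_mul,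
      div_mul_cancel₀ _ (by positivity), adjoint_polyShift_mul_apply]
  · rw [ContinuousLinearMap.adjoint_adjoint]
    have key : ∀ x : PolyFock n H, inner ℂ x (Y x) = ((‖B x‖ ^ 2 : ℝ) : ℂ) := by
      intro x
      refine IsFinsupp.dense.induction
        (P := fun x : PolyFock n H => inner ℂ x (Y x) = ((‖B x‖ ^ 2 : ℝ) : ℂ)) ?_ ?_ x
      · intro x hx
        rw [hform x hx, norm_sq_eq, formSum, Complex.ofReal_tsum]
        refine tsum_congr fun β => ?_
        rw [hB, norm_sq_smul_sqrt (polyCoeff_pos f m β).le, polyPow_eq_polyCoeff f m hm,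
          Complex.ofReal_mul]
      · refine isClosed_eq (by fun_prop) (Complex.continuous_ofReal.comp (by fun_prop))
    -- Over `ℂ` an operator is determined by its quadratic form.
    refine ContinuousLinearMap.coe_injective ((ext_inner_map _ _).1 fun x => ?_)
    rw [← inner_conj_symm]
    change (starRingEnd ℂ) (inner ℂ x (Y x)) = inner ℂ (ContinuousLinearMap.adjoint B (B x)) x
    rw [key, Complex.conj_ofReal, ContinuousLinearMap.adjoint_inner_left,
      inner_self_eq_norm_sq_to_K]
    norm_cast

end Factorization

/-! ### Partial isometries and projections -/

section PartialIsometry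

variable {K L : Type u} [NormedAddCommGroup K] [InnerProductSpace ℂ K]
  [NormedAddCommGroup L] [InnerProductSpace ℂ L] {V : K →L[ℂ] L}

theorem apply_eq_zero_of_mem_ker {x : K} (hx : x ∈ LinearMap.ker (V : K →ₗ[ℂ] L)) : V x = 0 := hx

theorem IsPartialIsometry.inner_map_map (hV : IsPartialIsometry V) {x y : K}
    (hx : x ∈ (LinearMap.ker (V : K →ₗ[ℂ] L))ᗮ) (hy : y ∈ (LinearMap.ker (V : K →ₗ[ℂ] L))ᗮ) :
    inner ℂ (V x) (V y) = inner ℂ x y := by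
  let T : (LinearMap.ker (V : K →ₗ[ℂ] L))ᗮ →ₗᵢ[ℂ] L :=
    { toLinearMap := (V : K →ₗ[ℂ] L) ∘ₗ Submodule.subtype _
      norm_map' := fun z => hV z z.2 }
  exact T.inner_map_map ⟨x, hx⟩ ⟨y, hy⟩

variable [CompleteSpace K] [CompleteSpace L]

theorem adjoint_mem_orthogonal_ker (y : L) :
    ContinuousLinearMap.adjoint V y ∈ (LinearMap.ker (V : K →ₗ[ℂ] L))ᗮ := by
  intro x hx
  rw [ContinuousLinearMap.adjoint_inner_right, apply_eq_zero_of_mem_ker hx, inner_zero_left]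

/-- The vector `V V^* y` lies in the range, and `y - V V^* y` is orthogonal to it because `V`
preserves inner products on the complement of its kernel, which contains `V^* y`. -/
theorem IsPartialIsometry.comp_adjoint_eq_starProjection (hV : IsPartialIsometry V)
    {M : Submodule ℂ L} [M.HasOrthogonalProjection] (hM : (M : Set L) = Set.range V) :
    M.starProjection = V ∘L ContinuousLinearMap.adjoint V := by
  have hcl : IsClosed (LinearMap.ker (V : K →ₗ[ℂ] L) : Set K) := V.isClosed_ker
  have : CompleteSpace (LinearMap.ker (V : K →ₗ[ℂ] L)) := hcl.completeSpace_coe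
  ext y
  refine Submodule.eq_starProjection_of_mem_orthogonal ?_ ?_
  · rw [← SetLike.mem_coe, hM]
    exact ⟨_, rfl⟩
  · intro z hz
    rw [← SetLike.mem_coe, hM] at hz
    obtain ⟨x, rfl⟩ := hz
    obtain ⟨x₁, h₁, x₂, h₂, rfl⟩ :=
      (LinearMap.ker (V : K →ₗ[ℂ] L)).exists_add_mem_mem_orthogonal x
    rw [map_add, apply_eq_zero_of_mem_ker h₁, zero_add, inner_sub_right,
      ContinuousLinearMap.comp_apply, hV.inner_map_map h₂ (adjoint_mem_orthogonal_ker y),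
      ContinuousLinearMap.adjoint_inner_right, sub_self]

theorem isPartialIsometry_of_starProjection_eq {M : Submodule ℂ L} [M.HasOrthogonalProjection]
    (h : M.starProjection = V ∘L ContinuousLinearMap.adjoint V) :
    IsPartialIsometry V ∧ (M : Set L) = Set.range V := by
  have happ : ∀ y, M.starProjection y = V (ContinuousLinearMap.adjoint V y) := fun y => by
    rw [h, ContinuousLinearMap.comp_apply]
  have hmem : ∀ x, V x ∈ M := by
    intro x
    rw [← Submodule.orthogonal_orthogonal M]
    intro z hz
    have h0 : ContinuousLinearMap.adjoint V z = 0 := by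
      rw [← inner_self_eq_zero (𝕜 := ℂ), ContinuousLinearMap.adjoint_inner_left, ← happ,
        (Submodule.starProjection_apply_eq_zero_iff M).2 hz, inner_zero_right]
    rw [← ContinuousLinearMap.adjoint_inner_left, h0, inner_zero_left]
  constructor
  · intro x hx
    -- This `w` lies both in the kernel, as `V V^*` fixes the range of `V`, and in its orthogonal
    -- complement; so `V^* V x = x`.
    set w := ContinuousLinearMap.adjoint V (V x) - x with hw
    have h1 : w ∈ LinearMap.ker (V : K →ₗ[ℂ] L) := by
      change V w = 0
      rw [hw, map_sub, ← happ, Submodule.starProjection_eq_self_iff.2 (hmem x), sub_self]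
    have h2 : w ∈ (LinearMap.ker (V : K →ₗ[ℂ] L))ᗮ :=
      Submodule.sub_mem _ (adjoint_mem_orthogonal_ker _) hx
    have h3 : w = 0 := inner_self_eq_zero.1 (h2 w h1)
    have h4 : ContinuousLinearMap.adjoint V (V x) = x := sub_eq_zero.1 h3
    have h5 : inner ℂ (V x) (V x) = (inner ℂ x x : ℂ) := by
      rw [← ContinuousLinearMap.adjoint_inner_left, h4]
    rw [inner_self_eq_norm_sq_to_K, inner_self_eq_norm_sq_to_K] at h5
    have h6 : ‖V x‖ ^ 2 = ‖x‖ ^ 2 := by exact_mod_cast h5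
    exact (sq_eq_sq₀ (norm_nonneg _) (norm_nonneg _)).1 h6
  · ext y
    constructor
    · intro hy
      exact ⟨_, (happ y).symm.trans (Submodule.starProjection_eq_self_iff.2 hy)⟩
    · rintro ⟨x, rfl⟩
      exact hmem x

end PartialIsometry

/-! ### Restrictions to invariant subspaces -/

section Restriction

variable {K : Type u} [NormedAddCommGroup K] [InnerProductSpace ℂ K] [CompleteSpace K]

theorem adjoint_lift_one {N : ℕ} (X : Fin N → K →L[ℂ] K) :
    ContinuousLinearMap.adjoint (FreeMonoid.lift X 1) = ContinuousLinearMap.id ℂ K := by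
  rw [map_one]
  exact ContinuousLinearMap.adjoint_id

theorem adjoint_lift_of_mul {N : ℕ} (X : Fin N → K →L[ℂ] K) (j : Fin N) (α : FreeMonoid (Fin N)) :
    ContinuousLinearMap.adjoint (FreeMonoid.lift X (FreeMonoid.of j * α)) =
      ContinuousLinearMap.adjoint (FreeMonoid.lift X α) ∘L ContinuousLinearMap.adjoint (X j) := by
  rw [map_mul, FreeMonoid.lift_eval_of]
  exact ContinuousLinearMap.adjoint_comp _ _

variable {N : ℕ} (f : PositiveRegular N) {X : Fin N → K →L[ℂ] K} (M : Submodule ℂ K)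
  [CompleteSpace M] (hM : ∀ (j : Fin N), ∀ x ∈ M, X j x ∈ M)

theorem adjoint_restrictTo (T : K →L[ℂ] K) (hT : ∀ x ∈ M, T x ∈ M) (x : K) :
    ContinuousLinearMap.adjoint (restrictTo T M hT) (ContinuousLinearMap.adjoint M.subtypeL x)
      = ContinuousLinearMap.adjoint M.subtypeL (ContinuousLinearMap.adjoint T x) := by
  refine ext_inner_left ℂ fun z => ?_
  rw [ContinuousLinearMap.adjoint_inner_right, ContinuousLinearMap.adjoint_inner_right,
    ContinuousLinearMap.adjoint_inner_right, ContinuousLinearMap.adjoint_inner_right]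
  rfl

theorem adjoint_lift_restrictTo (α : FreeMonoid (Fin N)) (x : K) :
    ContinuousLinearMap.adjoint (FreeMonoid.lift (fun j => restrictTo (X j) M (hM j)) α)
        (ContinuousLinearMap.adjoint M.subtypeL x)
      = ContinuousLinearMap.adjoint M.subtypeL
          (ContinuousLinearMap.adjoint (FreeMonoid.lift X α) x) := by
  induction α using FreeMonoid.inductionOn' generalizing x with
  | one =>
    rw [adjoint_lift_one, adjoint_lift_one]
    rfl
  | of_mul j α ih =>
    rw [adjoint_lift_of_mul, adjoint_lift_of_mul, ContinuousLinearMap.comp_apply,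
      ContinuousLinearMap.comp_apply, adjoint_restrictTo, ih]

theorem adjoint_subtypeL_coe (x : M) : ContinuousLinearMap.adjoint M.subtypeL (x : K) = x := by
  refine ext_inner_left ℂ fun z => ?_
  rw [ContinuousLinearMap.adjoint_inner_right]
  rfl

theorem norm_adjoint_subtypeL_le (x : K) :
    ‖ContinuousLinearMap.adjoint M.subtypeL x‖ ≤ ‖x‖ := by
  refine (ContinuousLinearMap.le_opNorm _ _).trans ?_
  rw [LinearIsometryEquiv.norm_map]
  exact mul_le_of_le_one_left (norm_nonneg x) (Submodule.norm_subtypeL_le M)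

theorem starProjection_eq_subtypeL_comp_adjoint :
    M.starProjection = M.subtypeL ∘L ContinuousLinearMap.adjoint M.subtypeL := by
  ext x
  refine Submodule.eq_starProjection_of_mem_orthogonal (Subtype.coe_prop _) ?_
  intro z hz
  rw [inner_sub_right, sub_eq_zero]
  change _ = inner ℂ (⟨z, hz⟩ : M) (ContinuousLinearMap.adjoint M.subtypeL x)
  rw [ContinuousLinearMap.adjoint_inner_right]
  rfl

variable {f}

theorem IsRowContraction.restrictTo (h : IsRowContraction f X) :
    IsRowContraction f fun j => restrictTo (X j) M (hM j) := by
  intro s x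
  refine le_trans (Finset.sum_le_sum fun α _ => ?_) (h s (x : K))
  refine mul_le_mul_of_nonneg_left ?_ (f.coeff_nonneg α)
  have e := adjoint_lift_restrictTo M hM α (x : K)
  rw [adjoint_subtypeL_coe] at e
  rw [e]
  exact pow_le_pow_left₀ (norm_nonneg _) (norm_adjoint_subtypeL_le M _) 2

/-- With `J` the inclusion of `M`, invariance gives `X_α J = J V_α` for the restrictions `V`, so
conjugation by `J` passes through every term. -/
theorem IsRowContraction.phi_subtypeL_comp (h : IsRowContraction f X) (Z : M →L[ℂ] M) :
    phi f X (M.subtypeL ∘L Z ∘L ContinuousLinearMap.adjoint M.subtypeL)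
      = M.subtypeL ∘L phi f (fun j => Polydomain.restrictTo (X j) M (hM j)) Z ∘L
          ContinuousLinearMap.adjoint M.subtypeL := by
  refine phi_eq fun x y => ?_
  have h1 := (h.restrictTo M hM).hasSum_inner_phi Z (ContinuousLinearMap.adjoint M.subtypeL x)
    (ContinuousLinearMap.adjoint M.subtypeL y)
  simp only [adjoint_lift_restrictTo] at h1
  simpa only [ContinuousLinearMap.comp_apply, ← ContinuousLinearMap.adjoint_inner_left] using h1

theorem defect_subtypeL_comp {k : ℕ} {n : Fin k → ℕ} {f : ∀ i, PositiveRegular (n i)}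
    {T : ∀ i, Fin (n i) → K →L[ℂ] K} (h : ∀ i, IsRowContraction (f i) (T i)) (M : Submodule ℂ K)
    [CompleteSpace M] (hM : ∀ (i : Fin k) (j : Fin (n i)), ∀ x ∈ M, T i j x ∈ M) (p : Fin k → ℕ)
    (Y : M →L[ℂ] M) :
    defect f T p (M.subtypeL ∘L Y ∘L ContinuousLinearMap.adjoint M.subtypeL)
      = M.subtypeL ∘L defect f (fun i j => restrictTo (T i j) M (hM i j)) p Y ∘L
          ContinuousLinearMap.adjoint M.subtypeL := by
  have step : ∀ (i : Fin k) (q : ℕ) (Z : M →L[ℂ] M),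
      (fun Z' => Z' - phi (f i) (T i) Z')^[q]
        (M.subtypeL ∘L Z ∘L ContinuousLinearMap.adjoint M.subtypeL)
      = M.subtypeL ∘L (fun Z' => Z' - phi (f i) (fun j => restrictTo (T i j) M (hM i j)) Z')^[q] Z
          ∘L ContinuousLinearMap.adjoint M.subtypeL := by
    intro i q
    induction q with
    | zero => intro Z; rfl
    | succ q ih =>
      intro Z
      rw [Function.iterate_succ_apply, Function.iterate_succ_apply, ← ih,
        (h i).phi_subtypeL_comp M (hM i), ContinuousLinearMap.sub_comp,
        ContinuousLinearMap.comp_sub]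
  unfold defect
  rw [Fin.foldr_eq_foldr_finRange, Fin.foldr_eq_foldr_finRange]
  induction List.finRange k with
  | nil => rfl
  | cons i l ih => rw [List.foldr_cons, List.foldr_cons, ih, step]

end Restriction

/-! ### Doubly commuting row contractions -/

section DoublyCommuting

variable {K : Type u} [NormedAddCommGroup K] [InnerProductSpace ℂ K] [CompleteSpace K]

section Single

variable {N : ℕ} {f : PositiveRegular N} {X : Fin N → K →L[ℂ] K} {S : K →L[ℂ] K}

theorem commute_adjoint_lift (hS : ∀ j, Commute S (ContinuousLinearMap.adjoint (X j)))
    (α : FreeMonoid (Fin N)) (x : K) :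
    ContinuousLinearMap.adjoint (FreeMonoid.lift X α) (S x)
      = S (ContinuousLinearMap.adjoint (FreeMonoid.lift X α) x) := by
  induction α using FreeMonoid.inductionOn' generalizing x with
  | one =>
    rw [adjoint_lift_one]
    rfl
  | of_mul j α ih =>
    rw [adjoint_lift_of_mul, ContinuousLinearMap.comp_apply, ContinuousLinearMap.comp_apply, ← ih]
    have e : ContinuousLinearMap.adjoint (X j) (S x) = S (ContinuousLinearMap.adjoint (X j) x) :=
      congrArg (fun T : K →L[ℂ] K => T x) (hS j).eq.symm
    rw [e]

/-- Each term satisfies `X_α S X_α^* = X_α X_α^* S`. -/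
theorem IsRowContraction.phi_eq_mul (h : IsRowContraction f X)
    (hS : ∀ j, Commute S (ContinuousLinearMap.adjoint (X j))) :
    phi f X S = phi f X 1 * S := by
  refine phi_eq fun x y => ?_
  have h1 := h.hasSum_inner_phi 1 x (S y)
  simp only [commute_adjoint_lift hS] at h1
  exact h1

theorem IsRowContraction.phi_eq_mul' (h : IsRowContraction f X)
    (hS : ∀ j, Commute (ContinuousLinearMap.adjoint S) (ContinuousLinearMap.adjoint (X j))) :
    phi f X S = S * phi f X 1 := by
  refine phi_eq fun x y => ?_
  have h1 := h.hasSum_inner_phi 1 (ContinuousLinearMap.adjoint S x) y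
  rw [ContinuousLinearMap.adjoint_inner_left] at h1
  refine h1.congr_fun fun α => ?_
  rw [commute_adjoint_lift hS, ContinuousLinearMap.adjoint_inner_left S]
  rfl

theorem IsRowContraction.isPositive_one_sub_phi (h : IsRowContraction f X) :
    (1 - phi f X 1).IsPositive := by
  rw [ContinuousLinearMap.isPositive_iff_complex]
  intro x
  have h1 := h.hasSum_inner_phi 1 x x
  have e : ∀ α, ((f.coeff α : ℂ) * inner ℂ (ContinuousLinearMap.adjoint (FreeMonoid.lift X α) x)
      ((1 : K →L[ℂ] K) (ContinuousLinearMap.adjoint (FreeMonoid.lift X α) x)))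
      = ((f.coeff α * ‖ContinuousLinearMap.adjoint (FreeMonoid.lift X α) x‖ ^ 2 : ℝ) : ℂ) := by
    intro α
    rw [Complex.ofReal_mul, Complex.ofReal_pow]
    exact congrArg _ (inner_self_eq_norm_sq_to_K _)
  simp only [e] at h1
  have hs : Summable fun α =>
      f.coeff α * ‖ContinuousLinearMap.adjoint (FreeMonoid.lift X α) x‖ ^ 2 :=
    Complex.summable_ofReal.1 h1.summable
  have h2 := h1.tsum_eq
  rw [← Complex.ofReal_tsum] at h2
  set c := ∑' α, f.coeff α * ‖ContinuousLinearMap.adjoint (FreeMonoid.lift X α) x‖ ^ 2 with hc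
  have hle : c ≤ ‖x‖ ^ 2 := hs.tsum_le_of_sum_le fun s => h s x
  have e2 : inner ℂ ((1 - phi f X 1) x) x = ((‖x‖ ^ 2 - c : ℝ) : ℂ) := by
    have e3 : inner ℂ ((1 : K →L[ℂ] K) x) x = ((‖x‖ ^ 2 : ℝ) : ℂ) :=
      (inner_self_eq_norm_sq_to_K x).trans (by norm_cast)
    rw [sub_apply, inner_sub_left, e3, ← inner_conj_symm (phi f X 1 x) x, ← h2,
      Complex.conj_ofReal, Complex.ofReal_sub]
  rw [e2]
  rw [RCLike.re_to_complex, Complex.ofReal_re]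
  exact ⟨rfl, sub_nonneg.2 hle⟩

end Single

/-- With exponents at most one, the defect of the identity is the product of the operators `1 -
Φ_i(1)` with `p i = 1`. The induction carries along that a partial product commutes with the
remaining tuples and their adjoints, which lets the next factor be pulled out and keeps the product
positive. -/
theorem isPositive_defect_of_doublyCommuting {k : ℕ} {n : Fin k → ℕ}
    {f : ∀ i, PositiveRegular (n i)} {T : ∀ i, Fin (n i) → K →L[ℂ] K}
    (h : ∀ i, IsRowContraction (f i) (T i))
    (hcomm : ∀ i j, i ≠ j → ∀ (p : Fin (n i)) (q : Fin (n j)), Commute (T i p) (T j q))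
    (hT : DoublyCommuting T) {p : Fin k → ℕ} (hp : ∀ i, p i ≤ 1) :
    (defect f T p 1).IsPositive := by
  have hstar : ∀ i j, i ≠ j → ∀ (p : Fin (n i)) (q : Fin (n j)),
      Commute (ContinuousLinearMap.adjoint (T i p)) (ContinuousLinearMap.adjoint (T j q)) :=
    fun i j hij p q => (hcomm i j hij p q).star_star
  have hmix : ∀ i j, i ≠ j → ∀ (p : Fin (n i)) (q : Fin (n j)),
      Commute (T i p) (ContinuousLinearMap.adjoint (T j q)) := hT
  have key : ∀ l : List (Fin k), l.Nodup →
      0 ≤ l.foldr (fun i Z => (fun Z' => Z' - phi (f i) (T i) Z')^[p i] Z) (1 : K →L[ℂ] K) ∧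
      ∀ i, i ∉ l → ∀ j,
        Commute (l.foldr (fun i Z => (fun Z' => Z' - phi (f i) (T i) Z')^[p i] Z)
          (1 : K →L[ℂ] K)) (T i j) ∧
        Commute (l.foldr (fun i Z => (fun Z' => Z' - phi (f i) (T i) Z')^[p i] Z)
          (1 : K →L[ℂ] K)) (ContinuousLinearMap.adjoint (T i j)) := by
    intro l
    induction l with
    | nil =>
      intro _
      refine ⟨?_, fun i _ j => ⟨Commute.one_left _, Commute.one_left _⟩⟩
      exact (ContinuousLinearMap.nonneg_iff_isPositive _).2 ContinuousLinearMap.isPositive_one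
    | cons i l ih =>
      intro hl
      obtain ⟨hi, hl⟩ := List.nodup_cons.1 hl
      obtain ⟨h0, hc⟩ := ih hl
      rw [List.foldr_cons]
      set Z := l.foldr (fun i Z => (fun Z' => Z' - phi (f i) (T i) Z')^[p i] Z) (1 : K →L[ℂ] K)
      rcases Nat.le_one_iff_eq_zero_or_eq_one.1 (hp i) with hpi | hpi
      · rw [hpi]
        exact ⟨h0, fun i' hi' j => hc i' (fun hmem => hi' (List.mem_cons_of_mem _ hmem)) j⟩
      · have hsa : ContinuousLinearMap.adjoint Z = Z :=
          ((ContinuousLinearMap.nonneg_iff_isPositive _).1 h0).isSelfAdjoint.adjoint_eq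
        have e1 := (h i).phi_eq_mul fun j => (hc i hi j).2
        have e2 := (h i).phi_eq_mul' (S := Z) fun j => by rw [hsa]; exact (hc i hi j).2
        have e3 : (fun Z' => Z' - phi (f i) (T i) Z')^[p i] Z = (1 - phi (f i) (T i) 1) * Z := by
          rw [hpi, Function.iterate_one, sub_mul, one_mul, e1]
        rw [e3]
        -- Both `Φ_i(1) S` and `S Φ_i(1)` equal `Φ_i(S)`.
        have hX : ∀ S : K →L[ℂ] K, (∀ j, Commute S (ContinuousLinearMap.adjoint (T i j))) →
            (∀ j, Commute (ContinuousLinearMap.adjoint S) (ContinuousLinearMap.adjoint (T i j))) →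
            Commute (1 - phi (f i) (T i) 1) S := fun S h1 h2 =>
          (Commute.one_left S).sub_left
            (((h i).phi_eq_mul h1).symm.trans ((h i).phi_eq_mul' h2))
        refine ⟨Commute.mul_nonneg ((ContinuousLinearMap.nonneg_iff_isPositive _).2
          (h i).isPositive_one_sub_phi) h0 ?_, ?_⟩
        · exact (Commute.one_left Z).sub_left (e1.symm.trans e2)
        · intro i' hi' j
          have hne : i' ≠ i := fun e => hi' (e ▸ List.mem_cons_self)
          obtain ⟨h1, h2⟩ := hc i' (fun hmem => hi' (List.mem_cons_of_mem _ hmem)) j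
          refine ⟨(hX _ (fun q => hmix i' i hne j q) fun q => hstar i' i hne j q).mul_left h1,
            (hX _ (fun q => hstar i' i hne j q) fun q => ?_).mul_left h2⟩
          rw [ContinuousLinearMap.adjoint_adjoint]
          exact hmix i' i hne j q
  rw [defect, Fin.foldr_eq_foldr_finRange]
  exact (ContinuousLinearMap.nonneg_iff_isPositive _).1 (key _ (List.nodup_finRange k)).1

end DoublyCommuting

/-! ### Beurling type subspaces of the model -/

section Beurling

variable {k : ℕ} {n : Fin k → ℕ} {f : ∀ i, PositiveRegular (n i)} {m : Fin k → ℕ}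
  {H : Type u} [NormedAddCommGroup H] [InnerProductSpace ℂ H] [CompleteSpace H]

/-- Both directions pass through `P_M = Ψ Ψ^*`; the converse uses only the exponent `p = m`. -/
theorem isBeurlingType_iff (hm : ∀ i, 1 ≤ m i) (M : Submodule ℂ (PolyFock n H))
    [CompleteSpace M] :
    IsBeurlingType f m M ↔ ∀ p : Fin k → ℕ, p ≤ m →
      (defect f (model f m H) p M.starProjection).IsPositive := by
  constructor
  · rintro ⟨E, _, _, _, Ψ, ⟨h1, h2⟩, hM⟩ p hp
    rw [h2.comp_adjoint_eq_starProjection hM]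
    exact h1.isPositive_defect hm hp
  · intro h
    obtain ⟨A, hA, e⟩ := exists_isMultiAnalytic hm (h m le_rfl)
    obtain ⟨h1, h2⟩ := isPartialIsometry_of_starProjection_eq e
    exact ⟨PolyFock n H, inferInstance, inferInstance, inferInstance, A, ⟨hA, h1⟩, h2⟩

theorem model_comp_model {i j : Fin k} (hij : i ≠ j) (p : Fin (n i)) (q : Fin (n j)) :
    model f m H i p ∘L model f m H j q = model f m H j q ∘L model f m H i p := by
  rw [model_eq_polyShift, model_eq_polyShift, ← polyShift_mul, ← polyShift_mul,
    (Pi.mulSingle_commute hij _ _).eq]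

theorem isPositive_defect_starProjection (hm : ∀ i, m i = 1) (M : Submodule ℂ (PolyFock n H))
    [CompleteSpace M] (hM : ∀ (i : Fin k) (j : Fin (n i)), ∀ x ∈ M, model f m H i j x ∈ M)
    (hT : DoublyCommuting fun i j => restrictTo (model f m H i j) M (hM i j))
    {p : Fin k → ℕ} (hp : p ≤ m) :
    (defect f (model f m H) p M.starProjection).IsPositive := by
  have hrow : ∀ i, IsRowContraction (f i) (model f m H i) :=
    isRowContraction_model fun i => (hm i).ge
  have e : M.starProjection
      = M.subtypeL ∘L (1 : M →L[ℂ] M) ∘L ContinuousLinearMap.adjoint M.subtypeL :=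
    starProjection_eq_subtypeL_comp_adjoint M
  rw [e, defect_subtypeL_comp hrow M hM]
  refine ContinuousLinearMap.IsPositive.conj_adjoint ?_ _
  refine isPositive_defect_of_doublyCommuting (fun i => (hrow i).restrictTo M (hM i)) ?_ hT
    fun i => (hp i).trans (hm i).le
  intro i j hij q r
  refine ContinuousLinearMap.ext fun x => Subtype.ext ?_
  exact congrArg (fun T : PolyFock n H →L[ℂ] PolyFock n H => T x) (model_comp_model hij q r)

end Beurling

end Polydomain

end

theorem mainTheorem6 {k : ℕ} (hk : 1 ≤ k) (n m : Fin k → ℕ) (hn : ∀ i, 1 ≤ n i)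
    (hm : ∀ i, 1 ≤ m i) (f : ∀ i, Polydomain.PositiveRegular (n i))
    (H : Type u) [NormedAddCommGroup H] [InnerProductSpace ℂ H] [CompleteSpace H] :
    -- the series defining the maps `Φ_{f_i, 𝐖_i ⊗ I}` converge in the weak operator topology
    (∀ (i : Fin k) (Y : Polydomain.PolyFock n H →L[ℂ] Polydomain.PolyFock n H),
      Tendsto
        (fun N : ℕ => (ContinuousLinearMapWOT.ofCLM
            (Polydomain.phiPartialSum (f i) (Polydomain.model f m H i) Y N) :
              Polydomain.PolyFock n H →WOT[ℂ] Polydomain.PolyFock n H))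
        atTop
        (𝓝 (ContinuousLinearMapWOT.ofCLM
          (Polydomain.phi (f i) (Polydomain.model f m H i) Y)))) ∧
    -- the factorization theorem
    (∀ Y : Polydomain.PolyFock n H →L[ℂ] Polydomain.PolyFock n H,
      (∃ (E : Type u) (_ : NormedAddCommGroup E) (_ : InnerProductSpace ℂ E)
          (_ : CompleteSpace E) (A : Polydomain.PolyFock n E →L[ℂ] Polydomain.PolyFock n H),
          Polydomain.IsMultiAnalytic f m A ∧ Y = A ∘L ContinuousLinearMap.adjoint A) ↔
        ∀ p : Fin k → ℕ, p ≤ m → p ≠ 0 →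
          (Polydomain.defect f (Polydomain.model f m H) p Y).IsPositive) ∧
    -- closed (equivalently: complete) invariant subspaces
    (∀ (M : Submodule ℂ (Polydomain.PolyFock n H)) [CompleteSpace M]
      (hM : ∀ (i : Fin k) (j : Fin (n i)), ∀ x ∈ M, Polydomain.model f m H i j x ∈ M),
      (Polydomain.IsBeurlingType f m M ↔
        ∀ p : Fin k → ℕ, p ≤ m →
          (Polydomain.defect f (Polydomain.model f m H) p M.starProjection).IsPositive) ∧
      ((∀ i, m i = 1) →
        Polydomain.DoublyCommuting
          (fun i j => Polydomain.restrictTo (Polydomain.model f m H i j) M (hM i j)) →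
        (∀ p : Fin k → ℕ, p ≤ m →
          (Polydomain.defect f (Polydomain.model f m H) p M.starProjection).IsPositive) ∧
        Polydomain.IsBeurlingType f m M)) := by
  refine ⟨fun i Y => ?_, fun Y => ⟨?_, fun h => ?_⟩, fun M _ hM =>
    ⟨Polydomain.isBeurlingType_iff hm M, fun hm1 hT => ?_⟩⟩
  · exact Polydomain.tendsto_phiPartialSum
      ((Polydomain.isRowContraction_model hm i).hasSum_inner_phi Y)
  · rintro ⟨E, _, _, _, A, hA, rfl⟩ p hp _
    exact hA.isPositive_defect hm hp
  -- As `k ≥ 1` and every `m i ≥ 1`, the tuple `m` is itself an admissible nonzero exponent.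
  · have h0 : m ≠ 0 := fun e => by
      have := hm ⟨0, hk⟩
      rw [e] at this
      exact absurd this (by simp)
    obtain ⟨A, hA, e⟩ := Polydomain.exists_isMultiAnalytic hm (h m le_rfl h0)
    exact ⟨Polydomain.PolyFock n H, inferInstance, inferInstance, inferInstance, A, hA, e⟩
  · have h : ∀ p : Fin k → ℕ, p ≤ m → (Polydomain.defect f (Polydomain.model f m H) p
        M.starProjection).IsPositive := fun p hp =>
      Polydomain.isPositive_defect_starProjection hm1 M hM hT hp
    exact ⟨h, (Polydomain.isBeurlingType_iff hm M).2 h⟩
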